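/- **Setting.** Let $\Omega\subset\mathbb R^n$ be a bounded domain with Lipschitz boundary $\Gamma$ and outward unit normal $N$, let $T>0$, $\nu>0$, $Q=\Omega\times(0,T)$, let $b,c\in L^\infty(\Omega;\mathbb R^n)$, and let $\rho_0\in L^2(\Omega)$ satisfy $\rho_0\ge 0$ a.e. and $\int_\Omega\rho_0\,dx=1$. Let $\otimes$ be the componentwise product in $\mathbb R^n$ and $B[u](x)=c(x)+b(x)\otimes u$. Let $H^1(\Omega)^*$ be the dual of $H^1(\Omega)$ and $$W(0,T)=\{\rho\in L^2(0,T;H^1(\Omega)):\ \partial_t\rho\in L^2(0,T;H^1(\Omega)^*)\}\hookrightarrow C([0,T];L^2(\Omega)).$$ For $u\in L^\infty(0,T;\mathbb R^n)$ let $G(u)\in W(0,T)$ be the weak solution $\rho$ of $\partial_t\rho-\nu\Delta\rho-\operatorname{div}(\rho B[u])=0$ in $Q$, $\rho(\cdot,0)=\rho_0$, $(\nu\nabla\rho+\rho B[u])\cdot N=0$ on $\Gamma\times(0,T)$; that is, $\rho(0)=\rho_0$ and, in the sense of distributions on $(0,T)$, for all $\varphi\in H^1(\Omega)$, $$\frac{d}{dt}\int_\Omega\rho\,\varphi\,dx+\int_\Omega(\nu\nabla\rho+\rho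 B[u(t)])\cdot\nabla\varphi\,dx=0 .$$ Let $\alpha_Q,\alpha_\Omega\in\mathbb R$, $\gamma_i,\beta_i\ge0$ $(i=1,\dots,n)$, $\rho_Q\in L^2(Q)$, $\rho_\Omega\in L^2(\Omega)$, $u^{\min},u^{\max}\in L^\infty(0,T;\mathbb R^n)$, and $$J(\rho,u)=\frac{\alpha_Q}2\int_0^T\|\rho(t)-\rho_Q(t)\|_{L^2(\Omega)}^2dt+\frac{\alpha_\Omega}2\|\rho(T)-\rho_\Omega\|_{L^2(\Omega)}^2+\sum_{i=1}^n\Big(\gamma_i\int_0^Tu_i^2\,dt+\beta_i\int_0^Tu_i\,dt\Big),$$ $$\mathcal U_{\rm ad}=\{u\in L^\infty(0,T;\mathbb R^n):\ u^{\min}\le u\le u^{\max}\text{ componentwise a.e. on }(0,T)\},\qquad F(u)=J(G(u),u).$$ A control $\bar u\in\mathcal U_{\rm ad}$ is an *$L^\infty$-local solution* if for some $\varepsilon>0$ one has $F(\bar u)\le F(u)$ for all $u\in\mathcal U_{\rm ad}$ with $\|u-\bar u\|_{L^\infty(0,T;\mathbb R^n)}<\varepsilon$. Assume moreover that $b\in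 W^{1,\infty}(\Omega;\mathbb R^n)$ and that for a.a. $x\in\Gamma$ one has $(b(x)\otimes u)\cdot N(x)=0$ for all $u\in\mathbb R^n$. **Theorem (second order necessary optimality condition).** Let $\bar u$ be an $L^\infty$-local solution. Then $G$ is well defined (for every $u\in L^\infty(0,T;\mathbb R^n)$ there is exactly one weak solution), $F$ is of class $C^2$ on $L^\infty(0,T;\mathbb R^n)$, and $F'(\bar u)$ and $F''(\bar u)$ extend (uniquely) to a continuous linear form on $L^2(0,T;\mathbb R^n)$ and a continuous bilinear form on $L^2(0,T;\mathbb R^n)^2$, denoted in the same way. These satisfy $$F''(\bar u)v^2\ \ge\ 0\qquad\text{for all }v\in C(\bar u),$$ where, with $S(\bar u)=\{\lambda(u-\bar u):\ \lambda>0,\ u\in\mathcal U_{\rm ad}\}$, the critical cone is $$C(\bar u)=\operatorname{cl}_{L^2(0,T;\mathbb R^n)}S(\bar u)\ \cap\ \{v\in L^2(0,T;\mathbb R^n):\ F'(\bar u)v=0\}.$$ -/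

import Mathlib

noncomputable section

namespace FokkerPlanck

open MeasureTheory Set Filter Topology
open scoped ENNReal ContDiff RealInnerProductSpace MeasureTheory

/-- `ℝⁿ` with the Euclidean norm. -/
abbrev E (n : ℕ) := EuclideanSpace ℝ (Fin n)

/-- The componentwise product `u ⊗ v` of two vectors. -/
def cmul {n : ℕ} (u v : E n) : E n := WithLp.toLp 2 (fun i => u i * v i)

/-! ### Domains with Lipschitz boundary and their normals -/

/-- Every boundary point of `Ω` has a ball in which `Ω` is the strict epigraph, in some direction
`e`, of a Lipschitz function on the hyperplane orthogonal to `e`. -/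
def HasLipschitzBoundary {n : ℕ} (Ω : Set (E n)) : Prop :=
  ∀ x ∈ frontier Ω, ∃ e : E n, ‖e‖ = 1 ∧ ∃ (K : NNReal) (g : (ℝ ∙ e)ᗮ → ℝ) (r : ℝ),
    LipschitzWith K g ∧ 0 < r ∧
      ∀ y ∈ Metric.ball x r, y ∈ Ω ↔ g ((ℝ ∙ e)ᗮ.orthogonalProjectionOnto y) < ⟪e, y⟫

/-- `N` is the outward unit normal of `Ω` at the boundary point `x`: near `x`, `Ω` agrees
up to thin cones around the tangent hyperplane with the half space `⟪y - x, N⟫ < 0`. -/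
def IsOuterUnitNormal {n : ℕ} (Ω : Set (E n)) (x N : E n) : Prop :=
  ‖N‖ = 1 ∧ ∀ ε > 0, ∀ᶠ y in 𝓝 x,
    (⟪y - x, N⟫ < -(ε * ‖y - x‖) → y ∈ Ω) ∧ (ε * ‖y - x‖ < ⟪y - x, N⟫ → y ∉ Ω)

/-! ### Sobolev spaces -/

/-- Smooth test functions with compact support in the set `U`. -/
def IsTestFunction {V : Type*} [NormedAddCommGroup V] [NormedSpace ℝ V] (U : Set V)
    (φ : V → ℝ) : Prop :=
  ContDiff ℝ ∞ φ ∧ HasCompactSupport φ ∧ tsupport φ ⊆ U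

/-- `g` is the weak gradient of `f` in `Ω`. -/
def IsWeakGradient {n : ℕ} (Ω : Set (E n)) (f : E n → ℝ) (g : E n → E n) : Prop :=
  ∀ φ : E n → ℝ, IsTestFunction Ω φ → ∀ e : E n,
    ∫ x in Ω, f x * fderiv ℝ φ x e = -∫ x in Ω, ⟪g x, e⟫ * φ x

/-- The space `L²(Ω)`. -/
abbrev L2 {n : ℕ} (Ω : Set (E n)) := Lp ℝ 2 (volume.restrict Ω)

/-- The Hilbert space `L²(Ω) × L²(Ω; ℝⁿ)`. -/
abbrev L2Pair {n : ℕ} (Ω : Set (E n)) :=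
  WithLp 2 (Lp ℝ 2 (volume.restrict Ω) × Lp (E n) 2 (volume.restrict Ω))

lemma IsTestFunction.memLp_fderiv {n : ℕ} {Ω : Set (E n)} {φ : E n → ℝ}
    (h : IsTestFunction Ω φ) (e : E n) :
    MemLp (fun x => fderiv ℝ φ x e) 2 (volume.restrict Ω) := by
  have hc : Continuous (fun x => fderiv ℝ φ x e) :=
    (h.1.continuous_fderiv (by simp)).clm_apply continuous_const
  have hs : HasCompactSupport (fun x => fderiv ℝ φ x e) := h.2.1.fderiv_apply ℝ e
  exact (hc.memLp_of_hasCompactSupport hs).restrict _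

lemma IsTestFunction.memLp {n : ℕ} {Ω : Set (E n)} {φ : E n → ℝ}
    (h : IsTestFunction Ω φ) : MemLp φ 2 (volume.restrict Ω) :=
  (h.1.continuous.memLp_of_hasCompactSupport h.2.1).restrict _

lemma integrable_mul_fderiv {n : ℕ} {Ω : Set (E n)} {φ : E n → ℝ}
    (h : IsTestFunction Ω φ) (f : Lp ℝ 2 (volume.restrict Ω)) (e : E n) :
    Integrable (fun x => f x * fderiv ℝ φ x e) (volume.restrict Ω) :=
  MemLp.integrable_mul (Lp.memLp f) (h.memLp_fderiv e)

lemma integrable_inner_mul {n : ℕ} {Ω : Set (E n)} {φ : E n → ℝ}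
    (h : IsTestFunction Ω φ) (g : Lp (E n) 2 (volume.restrict Ω)) (e : E n) :
    Integrable (fun x => ⟪g x, e⟫ * φ x) (volume.restrict Ω) :=
  MemLp.integrable_mul ((Lp.memLp g).inner_const e) h.memLp

/-- The Sobolev space `H¹(Ω)`: an element is a function in `L²(Ω)` together with its weak gradient
in `L²(Ω; ℝⁿ)` (which it determines), with the norm `(‖f‖² + ‖∇f‖²)^{1/2}`. -/
def H1 {n : ℕ} (Ω : Set (E n)) : Submodule ℝ (L2Pair Ω) where
  carrier := {f | IsWeakGradient Ω f.fst f.snd}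
  add_mem' := by
    intro f g hf hg φ hφ e
    have h1 : (fun x => (f + g).fst x * fderiv ℝ φ x e) =ᵐ[volume.restrict Ω]
        fun x => f.fst x * fderiv ℝ φ x e + g.fst x * fderiv ℝ φ x e := by
      filter_upwards [Lp.coeFn_add f.fst g.fst] with x hx
      rw [WithLp.add_fst, hx, Pi.add_apply, add_mul]
    have h2 : (fun x => ⟪(f + g).snd x, e⟫ * φ x) =ᵐ[volume.restrict Ω]
        fun x => ⟪f.snd x, e⟫ * φ x + ⟪g.snd x, e⟫ * φ x := by
      filter_upwards [Lp.coeFn_add f.snd g.snd] with x hx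
      rw [WithLp.add_snd, hx, Pi.add_apply, inner_add_left, add_mul]
    rw [integral_congr_ae h1, integral_congr_ae h2,
      integral_add (integrable_mul_fderiv hφ f.fst e) (integrable_mul_fderiv hφ g.fst e),
      integral_add (integrable_inner_mul hφ f.snd e) (integrable_inner_mul hφ g.snd e),
      hf φ hφ e, hg φ hφ e, neg_add]
  zero_mem' := by
    intro φ hφ e
    have h1 : (fun x => (0 : L2Pair Ω).fst x * fderiv ℝ φ x e) =ᵐ[volume.restrict Ω]
        fun _ => (0 : ℝ) := by
      filter_upwards [Lp.coeFn_zero ℝ 2 (volume.restrict Ω)] with x hx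
      rw [WithLp.zero_fst, hx, Pi.zero_apply, zero_mul]
    have h2 : (fun x => ⟪(0 : L2Pair Ω).snd x, e⟫ * φ x) =ᵐ[volume.restrict Ω]
        fun _ => (0 : ℝ) := by
      filter_upwards [Lp.coeFn_zero (E n) 2 (volume.restrict Ω)] with x hx
      rw [WithLp.zero_snd, hx, Pi.zero_apply, inner_zero_left, zero_mul]
    rw [integral_congr_ae h1, integral_congr_ae h2]
    simp
  smul_mem' := by
    intro a f hf φ hφ e
    have h1 : (fun x => (a • f).fst x * fderiv ℝ φ x e) =ᵐ[volume.restrict Ω]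
        fun x => a * (f.fst x * fderiv ℝ φ x e) := by
      filter_upwards [Lp.coeFn_smul a f.fst] with x hx
      rw [WithLp.smul_fst, hx, Pi.smul_apply, smul_eq_mul, mul_assoc]
    have h2 : (fun x => ⟪(a • f).snd x, e⟫ * φ x) =ᵐ[volume.restrict Ω]
        fun x => a * (⟪f.snd x, e⟫ * φ x) := by
      filter_upwards [Lp.coeFn_smul a f.snd] with x hx
      rw [WithLp.smul_snd, hx, Pi.smul_apply, real_inner_smul_left, mul_assoc]
    rw [integral_congr_ae h1, integral_congr_ae h2, integral_const_mul, integral_const_mul,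
      hf φ hφ e, mul_neg]

/-- The function in `L²(Ω)` underlying an element of `H¹(Ω)`. -/
def H1val {n : ℕ} {Ω : Set (E n)} (f : H1 Ω) : L2 Ω := (f : L2Pair Ω).fst

/-- The weak gradient of an element of `H¹(Ω)`. -/
def H1grad {n : ℕ} {Ω : Set (E n)} (f : H1 Ω) : Lp (E n) 2 (volume.restrict Ω) :=
  (f : L2Pair Ω).snd

/-- The vector field `b ∈ L^∞(Ω; ℝⁿ)` belongs to `W^{1,∞}(Ω; ℝⁿ)`. -/
def MemW1Infty {n : ℕ} (Ω : Set (E n)) (b : Lp (E n) ∞ (volume.restrict Ω)) : Prop :=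
  ∀ i : Fin n, ∃ g : Lp (E n) ∞ (volume.restrict Ω), IsWeakGradient Ω (fun x => b x i) g

/-! ### Spaces of functions of time -/

/-- `L²(0,T; H¹(Ω))`. -/
abbrev L2H1 {n : ℕ} (Ω : Set (E n)) (T : ℝ) := Lp (H1 Ω) 2 (volume.restrict (Ioo 0 T))

/-- `g ∈ L²(0,T; H¹(Ω)*)` is the distributional time derivative of `ρ`. -/
def IsTimeDeriv {n : ℕ} {Ω : Set (E n)} {T : ℝ} (ρ : L2H1 Ω T)
    (g : Lp (H1 Ω →L[ℝ] ℝ) 2 (volume.restrict (Ioo 0 T))) : Prop :=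
  ∀ φ : H1 Ω, ∀ η : ℝ → ℝ, IsTestFunction (Ioo 0 T) η →
    ∫ t in Ioo 0 T, ⟪H1val (ρ t), H1val φ⟫ * deriv η t = -∫ t in Ioo 0 T, g t φ * η t

/-- Membership in `W(0,T) = {ρ ∈ L²(0,T; H¹(Ω)) : ∂ₜρ ∈ L²(0,T; H¹(Ω)*)}`. -/
def MemW {n : ℕ} {Ω : Set (E n)} {T : ℝ} (ρ : L2H1 Ω T) : Prop := ∃ g, IsTimeDeriv ρ g

/-- `x ∈ L²(Ω)` is the value at time `t ∈ [0,T]` of the representative of `ρ` in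
`C([0,T]; L²(Ω))`. -/
def HasValueAt {n : ℕ} {Ω : Set (E n)} {T : ℝ} (ρ : L2H1 Ω T) (t : ℝ) (x : L2 Ω) : Prop :=
  ∃ y : ℝ → L2 Ω, ContinuousOn y (Icc 0 T) ∧
    (∀ᵐ s ∂(volume.restrict (Ioo 0 T)), y s = H1val (ρ s)) ∧ y t = x

/-- The value `ρ(t) ∈ L²(Ω)` of the continuous representative of `ρ`. -/
def valueAt {n : ℕ} {Ω : Set (E n)} {T : ℝ} (ρ : L2H1 Ω T) (t : ℝ) : L2 Ω :=
  Classical.epsilon (HasValueAt ρ t)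

/-- Controls in `L^∞(0,T; ℝⁿ)`. -/
abbrev UInf (n : ℕ) (T : ℝ) := Lp (E n) ∞ (volume.restrict (Ioo 0 T))

/-- `L²(0,T; ℝⁿ)`. -/
abbrev U2 (n : ℕ) (T : ℝ) := Lp (E n) 2 (volume.restrict (Ioo 0 T))

/-- The embedding of `L^∞(0,T; ℝⁿ)` in `L²(0,T; ℝⁿ)`. -/
def toU2 {n : ℕ} {T : ℝ} (u : UInf n T) : U2 n T := ⟨u.1, Lp.antitone le_top u.2⟩

/-! ### The control problem -/

/-- The data of the control problem. The desired state `ρQ ∈ L²(Q)`, `Q = Ω × (0,T)`, is regarded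
as an element of `L²(0,T; L²(Ω))`. -/
structure Data (n : ℕ) where
  Ω : Set (E n)
  T : ℝ
  ν : ℝ
  c : Lp (E n) ∞ (volume.restrict Ω)
  b : Lp (E n) ∞ (volume.restrict Ω)
  ρ₀ : L2 Ω
  αQ : ℝ
  αΩ : ℝ
  ρQ : Lp (L2 Ω) 2 (volume.restrict (Ioo 0 T))
  ρΩ : L2 Ω
  γ : Fin n → ℝ
  β : Fin n → ℝ
  umin : UInf n T
  umax : UInf n T

namespace Data

variable {n : ℕ} (P : Data n)

/-- The standing assumptions: `Ω` is a bounded domain with Lipschitz boundary, `ρ₀` is a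
probability density, and the signs of the constants. -/
structure Standing : Prop where
  isOpen : IsOpen P.Ω
  isConnected : IsConnected P.Ω
  isBounded : Bornology.IsBounded P.Ω
  lipschitz : HasLipschitzBoundary P.Ω
  T_pos : 0 < P.T
  ν_pos : 0 < P.ν
  ρ₀_nonneg : ∀ᵐ x ∂(volume.restrict P.Ω), 0 ≤ P.ρ₀ x
  ρ₀_integral : ∫ x in P.Ω, P.ρ₀ x = 1
  γ_nonneg : ∀ i, 0 ≤ P.γ i
  β_nonneg : ∀ i, 0 ≤ P.β i

/-- `b ∈ W^{1,∞}(Ω; ℝⁿ)`, and `(b ⊗ u) · N = 0` almost everywhere on the boundary for all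
`u ∈ ℝⁿ`. The boundary values of `b` are those of its continuous representative on the closure
of `Ω`; the boundary carries the Hausdorff measure of dimension `n - 1`. -/
def BoundaryAssumption : Prop :=
  MemW1Infty P.Ω P.b ∧
    ∃ b' : E n → E n, ContinuousOn b' (closure P.Ω) ∧ P.b =ᵐ[volume.restrict P.Ω] b' ∧
      ∀ᵐ x ∂((μH[(n : ℝ) - 1] : Measure (E n)).restrict (frontier P.Ω)),
        ∀ N : E n, IsOuterUnitNormal P.Ω x N → ∀ u : E n, ⟪cmul (b' x) u, N⟫ = 0

/-- The bilinear form `a[u](ψ,φ) = ∫_Ω (ν ∇ψ + ψ B[u]) · ∇φ dx`, where `B[u] = c + b ⊗ u`. -/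
def a (u : E n) (ψ φ : H1 P.Ω) : ℝ :=
  ∫ x in P.Ω, ⟪P.ν • H1grad ψ x + H1val ψ x • (P.c x + cmul (P.b x) u), H1grad φ x⟫

/-- `ρ ∈ W(0,T)` is a weak solution of the state equation with control `u`:
`d/dt (ρ(·),φ) + a[u(·)](ρ(·),φ) = 0` in the sense of distributions on `(0,T)` for all
`φ ∈ H¹(Ω)`, and `ρ(0) = ρ₀`. -/
def IsWeakSolution (u : UInf n P.T) (ρ : L2H1 P.Ω P.T) : Prop :=
  MemW ρ ∧
    (∀ φ : H1 P.Ω, ∀ η : ℝ → ℝ, IsTestFunction (Ioo 0 P.T) η →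
      -(∫ t in Ioo 0 P.T, ⟪H1val (ρ t), H1val φ⟫ * deriv η t) +
        ∫ t in Ioo 0 P.T, P.a (u t) (ρ t) φ * η t = 0) ∧
    HasValueAt ρ 0 P.ρ₀

/-- The control-to-state mapping. -/
def G (u : UInf n P.T) : L2H1 P.Ω P.T := Classical.epsilon (P.IsWeakSolution u)

/-- The cost functional. -/
def J (ρ : L2H1 P.Ω P.T) (u : UInf n P.T) : ℝ :=
  P.αQ / 2 * (∫ t in Ioo 0 P.T, ‖H1val (ρ t) - P.ρQ t‖ ^ 2) +
    P.αΩ / 2 * ‖valueAt ρ P.T - P.ρΩ‖ ^ 2 +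
    ∑ i, (P.γ i * (∫ t in Ioo 0 P.T, u t i ^ 2) + P.β i * ∫ t in Ioo 0 P.T, u t i)

/-- The reduced cost functional `F(u) = J(G(u),u)` on `L^∞(0,T; ℝⁿ)`. -/
def F (u : UInf n P.T) : ℝ := P.J (P.G u) u

/-- The admissible controls. -/
def Uad : Set (UInf n P.T) :=
  {u | ∀ᵐ t ∂(volume.restrict (Ioo 0 P.T)), ∀ i, P.umin t i ≤ u t i ∧ u t i ≤ P.umax t i}

/-- `L^∞`-local solutions of the control problem. -/
def IsLInftyLocalSolution (u : UInf n P.T) : Prop :=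
  u ∈ P.Uad ∧ ∃ ε > 0, ∀ w ∈ P.Uad ∩ Metric.ball u ε, P.F u ≤ P.F w

/-- The cone of feasible directions at `u`. -/
def feasibleCone (u : UInf n P.T) : Set (UInf n P.T) :=
  {v | ∃ l : ℝ, 0 < l ∧ ∃ w ∈ P.Uad, v = l • (w - u)}

/-- The critical cone at `u`, where `F'` is the extension to `L²(0,T; ℝⁿ)` of the derivative at `u`
of the reduced cost functional. -/
def criticalCone (u : UInf n P.T) (F' : U2 n P.T →L[ℝ] ℝ) : Set (U2 n P.T) :=
  closure (toU2 '' P.feasibleCone u) ∩ {v | F' v = 0}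

/-- `F'` is the continuous extension to `L²(0,T; ℝⁿ)` of the Fréchet derivative at `u` of the
reduced cost functional. -/
def IsExtensionOfDeriv (u : UInf n P.T) (F' : U2 n P.T →L[ℝ] ℝ) : Prop :=
  ∀ v : UInf n P.T, F' (toU2 v) = fderiv ℝ P.F u v

/-- `F''` is the continuous extension to `L²(0,T; ℝⁿ)` of the second Fréchet derivative at `u` of
the reduced cost functional. -/
def IsExtensionOfSecondDeriv (u : UInf n P.T) (F'' : U2 n P.T →L[ℝ] U2 n P.T →L[ℝ] ℝ) : Prop :=
  ∀ v w : UInf n P.T, F'' (toU2 v) (toU2 w) = fderiv ℝ (fderiv ℝ P.F) u v w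

end Data

end FokkerPlanck

end

/-! The control enters the state equation bilinearly. Write `A` for the diffusion and the fixed
drift, `B(u)` for the controlled drift, and let `K(u) y` be the solution of `z' + A z = B(u) y`,
`z(0) = 0`. The state is then the solution `y` in C([0,T]; L²(Ω)) of `y + K(u) y = y₁`, where `y₁`
solves the uncontrolled equation with initial value ρ₀. For `y` in this space, `y (b ⊗ u)` lies in
L²(0,T; L²) as soon as `u` is in L², so `u ↦ K(u)` is linear and continuous for the L² norm of the
control. If `u` is bounded, iterating the energy estimate produces a factor `1/m!`, hence a power of
`K(u)` is a contraction and `1 + K(u)` is invertible (`isRegular_of_bounded`). Inversion is smooth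
on the open set of units, so the state is a smooth function of the control on an L²-neighbourhood of
every bounded control (`contDiffAt_stateC`), and so is the cost. Thus `F` is this cost composed with
the embedding of L^∞ in L², and the derivatives taken in L² are the required extensions.

The linear equation is solved by density. C¹ functions `z` with values in `V` satisfy an energy
estimate in terms of their data `(z(0), z' + A z)`, and these data are dense, so the map from data
to `z` extends continuously. Density amounts to uniqueness for the backward equation
(`ae_eq_zero_of_backward`); after a reversal of time the same lemma gives uniqueness of weak
solutions.

For the second order condition, a direction `v` in the closure of the feasible cone has the right
sign wherever a bound is active. Setting `v` to zero where it is large, or where the control is near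
a bound without attaining it, gives bounded directions `v_k → v` in L² along which a short segment
is admissible. Both `v_k` and `v - v_k` satisfy the sign conditions, so `F'` is nonnegative at both;
since `F' v = 0`, also `F' v_k = 0`. Minimality along the segment then gives `F'' v_k² ≥ 0`, and `k
→ ∞` finishes the proof. -/

noncomputable section

namespace FokkerPlanck

open MeasureTheory Set Filter Topology
open scoped ENNReal ContDiff RealInnerProductSpace MeasureTheory

/-! ### An abstract parabolic equation -/

/-! ### Uniqueness for the backward equation. -/

section Parabolic

variable {V H : Type*} [NormedAddCommGroup V] [InnerProductSpace ℝ V]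
  [NormedAddCommGroup H] [InnerProductSpace ℝ H]

/-- Lebesgue measure on the time interval `(0,T)`. -/
abbrev timeMeasure (T : ℝ) : Measure ℝ := volume.restrict (Ioo 0 T)

/-- Gårding's inequality for the operator `A` on `V` with respect to the map `ι : V → H`. -/
def Garding (ι : V →L[ℝ] H) (A : V →L[ℝ] V) (α lam : ℝ) : Prop :=
  0 < α ∧ 0 ≤ lam ∧ ∀ v, α * ‖v‖ ^ 2 - lam * ‖ι v‖ ^ 2 ≤ ⟪A v, v⟫

lemma IsTestFunction.deriv_bound {U : Set ℝ} {k : ℝ → ℝ} (hk : IsTestFunction U k) :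
    ∃ C, ∀ x, ‖deriv k x‖ ≤ C :=
  hk.2.1.deriv.exists_bound_of_continuous (hk.1.continuous_deriv (by simp))

lemma IsTestFunction.comp_sub {k : ℝ → ℝ} {U : Set ℝ} (hk : IsTestFunction U k) {t : ℝ}
    {W : Set ℝ} (h : ∀ s, s - t ∈ U → s ∈ W) : IsTestFunction W (fun s => k (s - t)) := by
  refine ⟨hk.1.comp (contDiff_id.sub contDiff_const), ?_, ?_⟩
  · exact hk.2.1.comp_homeomorph (Homeomorph.subRight t)
  · have := tsupport_comp_eq_preimage k (Homeomorph.subRight t)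
    intro s hs
    have hs' : s ∈ tsupport (k ∘ (Homeomorph.subRight t)) := hs
    rw [this] at hs'
    exact h s (hk.2.2 hs')

lemma IsTestFunction.eq_zero {V : Type*} [NormedAddCommGroup V] [NormedSpace ℝ V] {k : V → ℝ}
    {U : Set V} (hk : IsTestFunction U k) {t : V} (ht : t ∉ U) : k t = 0 := by
  by_contra h
  exact ht (hk.2.2 (subset_tsupport k h))

lemma IsTestFunction.integrable_smul {U : Set ℝ} {k : ℝ → ℝ} (hk : IsTestFunction U k)
    {μ : Measure ℝ} {φ : ℝ → V} (hφ : Integrable φ μ) (t : ℝ) :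
    Integrable (fun s => k (s - t) • φ s) μ := by
  obtain ⟨C, hC⟩ := hk.2.1.exists_bound_of_continuous hk.1.continuous
  exact hφ.bdd_smul C (hk.1.continuous.comp (by fun_prop)).aestronglyMeasurable
    (ae_of_all _ fun s => hC _)

lemma IsTestFunction.integrable_deriv_smul {U : Set ℝ} {k : ℝ → ℝ} (hk : IsTestFunction U k)
    {μ : Measure ℝ} {φ : ℝ → V} (hφ : Integrable φ μ) (t : ℝ) :
    Integrable (fun s => deriv k (s - t) • φ s) μ := by
  obtain ⟨C, hC⟩ := hk.deriv_bound
  exact hφ.bdd_smul C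
    ((hk.1.continuous_deriv (by simp)).comp (by fun_prop)).aestronglyMeasurable
    (ae_of_all _ fun s => hC _)

lemma IsTestFunction.hasDerivAt_integral {U : Set ℝ} {k : ℝ → ℝ} (hk : IsTestFunction U k)
    {μ : Measure ℝ} {φ : ℝ → V} (hφ : Integrable φ μ) (t : ℝ) :
    HasDerivAt (fun t => ∫ s, k (s - t) • φ s ∂μ) (-∫ s, deriv k (s - t) • φ s ∂μ) t := by
  obtain ⟨C, hC⟩ := hk.deriv_bound
  have h := (hasDerivAt_integral_of_dominated_loc_of_deriv_le (μ := μ) (x₀ := t)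
    (F := fun t s => k (s - t) • φ s) (F' := fun t s => (-deriv k (s - t)) • φ s)
    (bound := fun s => C * ‖φ s‖) (s := univ) univ_mem
    (Eventually.of_forall fun t => (hk.integrable_smul hφ t).aestronglyMeasurable)
    (hk.integrable_smul hφ t) ?_ ?_ ?_ ?_).2
  · simpa [integral_neg] using h
  · simp only [neg_smul]
    exact (hk.integrable_deriv_smul hφ t).aestronglyMeasurable.neg
  · refine ae_of_all _ fun s x _ => ?_
    rw [norm_smul, norm_neg]
    gcongr
    exact hC _
  · exact hφ.norm.const_mul C
  · refine ae_of_all _ fun s x _ => ?_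
    have h1 : HasDerivAt k (deriv k (s - x)) (s - x) :=
      ((hk.1.differentiable (by simp)) _).hasDerivAt
    have h2 : HasDerivAt (fun x => s - x) (-1) x := by
      simpa using (hasDerivAt_id x).const_sub s
    simpa using (h1.scomp x h2).smul_const (φ s)

/-- A solution of the backward equation on `(0,T)` with zero final value vanishes. -/
lemma ae_eq_zero_of_backward [CompleteSpace V] {T : ℝ} (hT : 0 < T) {ι : V →L[ℝ] H}
    {A : V →L[ℝ] V} {α lam : ℝ} (hA : Garding ι A α lam) {φ : ℝ → V}
    (hφ : Integrable φ (timeMeasure T))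
    (h : ∀ w : V, ∀ η : ℝ → ℝ, IsTestFunction (Ioi 0) η →
      ∫ t in Ioo 0 T, (deriv η t * ⟪ι w, ι (φ t)⟫ + η t * ⟪A w, φ t⟫) = 0) :
    φ =ᵐ[timeMeasure T] 0 := by
  obtain ⟨hα, hlam, hA⟩ := hA
  -- The mollification `y(t) = ∫ k(s - t) φ(s) ds` satisfies `y(0) = ∫ k φ` and solves the backward
  -- equation for `t ≥ 0`. Shifting `k` to the right may push its support across `T`; this is
  -- admissible because the test functions in `h` need not vanish at `T`, which encodes the zero
  -- final value.
  have key : ∀ k : ℝ → ℝ, IsTestFunction (Ioo 0 T) k → ∫ s in Ioo 0 T, k s • φ s = 0 := by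
    intro k hk
    set y : ℝ → V := fun t => ∫ s in Ioo 0 T, k (s - t) • φ s with hy
    set y' : ℝ → V := fun t => -∫ s in Ioo 0 T, deriv k (s - t) • φ s with hy'
    have hd : ∀ t, HasDerivAt y (y' t) t := hk.hasDerivAt_integral hφ
    have heq : ∀ t, 0 ≤ t → ∀ w, ⟪ι w, ι (y' t)⟫ = ⟪A w, y t⟫ := by
      intro t ht w
      have h1 := h w (fun s => k (s - t)) (hk.comp_sub fun s hs => by
        simp only [mem_Ioo, mem_Ioi] at *; linarith)
      have hdk : ∀ s, deriv (fun s => k (s - t)) s = deriv k (s - t) := fun s => by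
        rw [deriv_comp_sub_const]
      simp only [hdk] at h1
      have e1 : ∀ s, deriv k (s - t) * ⟪ι w, ι (φ s)⟫ =
          (innerSL ℝ (ι w) ∘L ι) (deriv k (s - t) • φ s) := fun s => by simp
      have e2 : ∀ s, k (s - t) * ⟪A w, φ s⟫ = innerSL ℝ (A w) (k (s - t) • φ s) := fun s => by simp
      simp only [e1, e2] at h1
      rw [integral_add ((innerSL ℝ (ι w) ∘L ι).integrable_comp (hk.integrable_deriv_smul hφ t))
        ((innerSL ℝ (A w)).integrable_comp (hk.integrable_smul hφ t)),
        ContinuousLinearMap.integral_comp_comm _ (hk.integrable_deriv_smul hφ t),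
        ContinuousLinearMap.integral_comp_comm _ (hk.integrable_smul hφ t)] at h1
      simp only [ContinuousLinearMap.comp_apply, innerSL_apply_apply] at h1
      simp only [hy', hy, map_neg, inner_neg_right]
      linarith
    set q : ℝ → ℝ := fun t => ‖ι (y t)‖ ^ 2 with hq
    have hqd : ∀ t, 0 ≤ t → HasDerivAt q (2 * ⟪A (y t), y t⟫) t := by
      intro t ht
      have := (ι.hasFDerivAt.comp_hasDerivAt t (hd t)).norm_sq
      rw [Function.comp_apply, heq t ht] at this
      exact this
    -- Gårding gives `q' = 2⟪A y, y⟫ ≥ -2 lam q`. Since `q(T) = 0`, monotonicity forces `q(0) = 0`.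
    have hmono : MonotoneOn (fun t => Real.exp (2 * lam * t) * q t) (Icc 0 T) := by
      have hd' : ∀ t, 0 ≤ t → HasDerivAt (fun t => Real.exp (2 * lam * t) * q t)
          (Real.exp (2 * lam * t) * (2 * lam) * q t +
            Real.exp (2 * lam * t) * (2 * ⟪A (y t), y t⟫)) t := by
        intro t ht
        have h2 : HasDerivAt (fun t => Real.exp (2 * lam * t))
            (Real.exp (2 * lam * t) * (2 * lam)) t := by
          simpa using ((hasDerivAt_id t).const_mul (2 * lam)).exp
        exact h2.mul (hqd t ht)
      refine monotoneOn_of_deriv_nonneg (convex_Icc _ _)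
        (fun t ht => (hd' t ht.1).continuousAt.continuousWithinAt) ?_ ?_
      · intro t ht
        rw [interior_Icc] at ht
        exact (hd' t ht.1.le).differentiableAt.differentiableWithinAt
      · intro t ht
        rw [interior_Icc] at ht
        rw [(hd' t ht.1.le).deriv]
        have h3 := hA (y t)
        have h4 : 0 ≤ lam * q t + ⟪A (y t), y t⟫ := by
          have : 0 ≤ α * ‖y t‖ ^ 2 := by positivity
          simp only [hq]; linarith
        have := mul_nonneg (Real.exp_pos (2 * lam * t)).le h4
        linarith
    have hyT : y T = 0 := by
      refine integral_eq_zero_of_ae ?_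
      refine (ae_restrict_iff' measurableSet_Ioo).2 (ae_of_all _ fun s hs => ?_)
      have hs' : s - T ∉ Ioo 0 T := fun h => by linarith [h.1, hs.2]
      simp [hk.eq_zero hs']
    have hq0 : q 0 = 0 := by
      have := hmono (left_mem_Icc.2 hT.le) (right_mem_Icc.2 hT.le) hT.le
      simp only [hq, hyT] at this ⊢
      simp only [mul_zero, Real.exp_zero, one_mul, map_zero, norm_zero] at this
      have h0 := sq_nonneg ‖ι (y 0)‖
      simp at this ⊢
      exact this
    -- `ι` need not be injective, so `ι (y 0) = 0` is not yet enough. But `q` is differentiable at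
    -- `0` from both sides and minimal there, so `⟪A (y 0), y 0⟫ = 0`, and Gårding gives `y 0 = 0`.
    have hmin : IsLocalMin q 0 := by
      refine Eventually.of_forall fun t => ?_
      rw [hq0]; positivity
    have h0 := hmin.hasDerivAt_eq_zero (hqd 0 le_rfl)
    have h1 := hA (y 0)
    have h2 : ‖ι (y 0)‖ ^ 2 = 0 := hq0
    rw [h2] at h1
    have h3 : α * ‖y 0‖ ^ 2 ≤ 0 := by linarith
    have h4 : ‖y 0‖ ^ 2 ≤ 0 := by
      by_contra hcon
      push Not at hcon
      have := mul_pos hα hcon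
      linarith
    have h5 : y 0 = 0 := by
      have : ‖y 0‖ = 0 := by
        have := le_antisymm h4 (sq_nonneg _)
        exact pow_eq_zero_iff (two_ne_zero) |>.1 this
      exact norm_eq_zero.1 this
    simpa [hy] using h5
  have hloc : LocallyIntegrableOn φ (Ioo 0 T) volume :=
    IntegrableOn.locallyIntegrableOn hφ
  refine (ae_restrict_iff' measurableSet_Ioo).2
    (isOpen_Ioo.ae_eq_zero_of_integral_contDiff_smul_eq_zero hloc fun g hg1 hg2 hg3 => ?_)
  rw [← key g ⟨hg1, hg2, hg3⟩]
  symm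
  refine setIntegral_eq_integral_of_forall_compl_eq_zero fun s hs => ?_
  rw [IsTestFunction.eq_zero ⟨hg1, hg2, hg3⟩ hs, zero_smul]

end Parabolic

/-! ### The energy estimate and the density of the data of C¹ functions. -/

section Parabolic

variable {V H : Type*} [NormedAddCommGroup V] [InnerProductSpace ℝ V]
  [NormedAddCommGroup H] [InnerProductSpace ℝ H]

section ContinuousFunctions

variable {F : Type*} [NormedAddCommGroup F] [NormedSpace ℝ F] {T : ℝ}

/-- Restriction of a continuous function to `[0,T]`, extended by constants. -/
def extendBCF (hT : 0 ≤ T) : C(ℝ, F) →ₗ[ℝ] BoundedContinuousFunction ℝ F where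
  toFun f := (BoundedContinuousFunction.mkOfCompact (f.restrict (Icc 0 T))).compContinuous
    ⟨projIcc 0 T hT, continuous_projIcc⟩
  map_add' _ _ := rfl
  map_smul' _ _ := rfl

lemma extendBCF_apply (hT : 0 ≤ T) (f : C(ℝ, F)) (t : ℝ) :
    extendBCF hT f t = f (projIcc 0 T hT t) := rfl

lemma extendBCF_of_mem (hT : 0 ≤ T) (f : C(ℝ, F)) {t : ℝ} (ht : t ∈ Icc 0 T) :
    extendBCF hT f t = f t := by
  rw [extendBCF_apply, projIcc_of_mem hT ht]

/-- The class in `L²(0,T; F)` of a continuous function. -/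
def toTimeL2 (hT : 0 ≤ T) : C(ℝ, F) →ₗ[ℝ] Lp F 2 (timeMeasure T) :=
  (BoundedContinuousFunction.toLp 2 (timeMeasure T) ℝ).toLinearMap ∘ₗ extendBCF hT

lemma coeFn_toTimeL2 (hT : 0 ≤ T) (f : C(ℝ, F)) : toTimeL2 hT f =ᵐ[timeMeasure T] f := by
  refine (BoundedContinuousFunction.coeFn_toLp 2 (timeMeasure T) ℝ (extendBCF hT f)).trans ?_
  refine (ae_restrict_iff' measurableSet_Ioo).2 (ae_of_all _ fun s hs => ?_)
  exact extendBCF_of_mem hT f (Ioo_subset_Icc_self hs)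

end ContinuousFunctions

lemma norm_sq_eq_integral {F : Type*} [NormedAddCommGroup F] [InnerProductSpace ℝ F] {X : Type*}
    [MeasurableSpace X] {μ : Measure X} (f : Lp F 2 μ) : ‖f‖ ^ 2 = ∫ x, ‖f x‖ ^ 2 ∂μ := by
  rw [← real_inner_self_eq_norm_sq, L2.inner_def]
  simp only [real_inner_self_eq_norm_sq]

lemma integrable_norm_sq {F : Type*} [NormedAddCommGroup F] {X : Type*}
    [MeasurableSpace X] {μ : Measure X} (f : Lp F 2 μ) : Integrable (fun x => ‖f x‖ ^ 2) μ :=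
  (Lp.memLp f).integrable_norm_pow two_ne_zero

variable [CompleteSpace V] [CompleteSpace H]

/-- The continuously differentiable functions of time with values in `V`. -/
def C1 (V : Type*) [NormedAddCommGroup V] [NormedSpace ℝ V] : Submodule ℝ (ℝ → V) where
  carrier := {z | ContDiff ℝ 1 z}
  add_mem' {z w} (h : ContDiff ℝ 1 z) (h' : ContDiff ℝ 1 w) := show ContDiff ℝ 1 _ from h.add h'
  zero_mem' := show ContDiff ℝ 1 (fun _ => (0 : V)) from contDiff_const
  smul_mem' _ z (h : ContDiff ℝ 1 z) := show ContDiff ℝ 1 _ from contDiff_const.smul h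

lemma mem_C1 {V : Type*} [NormedAddCommGroup V] [NormedSpace ℝ V] {z : ℝ → V} :
    z ∈ C1 V ↔ ContDiff ℝ 1 z := Iff.rfl

lemma hasDerivAt_C1 {V : Type*} [NormedAddCommGroup V] [NormedSpace ℝ V] (z : C1 V) (t : ℝ) :
    HasDerivAt z.1 (deriv z.1 t) t :=
  (((mem_C1.1 z.2).differentiable one_ne_zero) t).hasDerivAt

lemma continuous_C1 {V : Type*} [NormedAddCommGroup V] [NormedSpace ℝ V] (z : C1 V) :
    Continuous z.1 := (mem_C1.1 z.2).continuous

lemma continuous_deriv_C1 {V : Type*} [NormedAddCommGroup V] [NormedSpace ℝ V] (z : C1 V) :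
    Continuous (deriv z.1) := (mem_C1.1 z.2).continuous_deriv le_rfl

/-- `ι* ι`, which represents the scalar product of `H` in `V`. -/
def gram (ι : V →L[ℝ] H) : V →L[ℝ] V := (ContinuousLinearMap.adjoint ι) ∘L ι

lemma inner_gram (ι : V →L[ℝ] H) (v w : V) : ⟪gram ι v, w⟫ = ⟪ι v, ι w⟫ :=
  ContinuousLinearMap.adjoint_inner_left ι w (ι v)

/-- The right hand side `z' + A z` belonging to a function `z`. -/
def sourceMap (ι : V →L[ℝ] H) (A : V →L[ℝ] V) : C1 V →ₗ[ℝ] C(ℝ, V) where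
  toFun z := ⟨fun t => gram ι (deriv z.1 t) + A (z.1 t), by
    have := continuous_C1 z; have := continuous_deriv_C1 z; fun_prop⟩
  map_add' z w := by
    ext t
    have : deriv (z.1 + w.1) t = deriv z.1 t + deriv w.1 t :=
      ((hasDerivAt_C1 z t).add (hasDerivAt_C1 w t)).deriv
    simp [this]
    abel
  map_smul' c z := by
    ext t
    have : deriv (c • z.1) t = c • deriv z.1 t := ((hasDerivAt_C1 z t).const_smul c).deriv
    simp [this]

/-- The continuous function `ι ∘ z`. -/
def stateMap (ι : V →L[ℝ] H) : C1 V →ₗ[ℝ] C(ℝ, H) where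
  toFun z := ⟨fun t => ι (z.1 t), by have := continuous_C1 z; fun_prop⟩
  map_add' z w := by ext t; simp
  map_smul' c z := by ext t; simp

/-- The inclusion of `C¹` functions in continuous functions. -/
def valMap (V : Type*) [NormedAddCommGroup V] [NormedSpace ℝ V] : C1 V →ₗ[ℝ] C(ℝ, V) where
  toFun z := ⟨z.1, continuous_C1 z⟩
  map_add' z w := by ext t; simp
  map_smul' c z := by ext t; simp

/-- The Hilbert space `H × L²(0,T; V)` of initial values and right hand sides. -/
abbrev DataSpace (V H : Type*) [NormedAddCommGroup V] [NormedAddCommGroup H] (T : ℝ) :=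
  WithLp 2 (H × Lp V 2 (timeMeasure T))

/-- The data `(z(0), z' + A z)` belonging to a function `z`. -/
def dataMap {T : ℝ} (hT : 0 ≤ T) (ι : V →L[ℝ] H) (A : V →L[ℝ] V) :
    C1 V →ₗ[ℝ] DataSpace V H T :=
  (WithLp.linearEquiv 2 ℝ (H × Lp V 2 (timeMeasure T))).symm.toLinearMap ∘ₗ
    LinearMap.prod (ι.toLinearMap ∘ₗ LinearMap.proj 0 ∘ₗ (C1 V).subtype)
      (toTimeL2 hT ∘ₗ sourceMap ι A)

/-- A function `z`, regarded as a continuous function with values in `H` and as an element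
of `L²(0,T; V)`. -/
def solMap {T : ℝ} (hT : 0 ≤ T) (ι : V →L[ℝ] H) :
    C1 V →ₗ[ℝ] BoundedContinuousFunction ℝ H × Lp V 2 (timeMeasure T) :=
  LinearMap.prod (extendBCF hT ∘ₗ stateMap ι) (toTimeL2 hT ∘ₗ valMap V)

lemma dataMap_fst {T : ℝ} (hT : 0 ≤ T) (ι : V →L[ℝ] H) (A : V →L[ℝ] V) (z : C1 V) :
    (dataMap hT ι A z).fst = ι (z.1 0) := rfl

lemma dataMap_snd {T : ℝ} (hT : 0 ≤ T) (ι : V →L[ℝ] H) (A : V →L[ℝ] V) (z : C1 V) :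
    (dataMap hT ι A z).snd = toTimeL2 hT (sourceMap ι A z) := rfl

/-- The energy estimate. -/
lemma energy_estimate {T : ℝ} {ι : V →L[ℝ] H} {A : V →L[ℝ] V} {α lam : ℝ}
    (hA : Garding ι A α lam) (z : C1 V) {t : ℝ} (ht : t ∈ Icc 0 T) :
    ‖ι (z.1 t)‖ ^ 2 + α * ∫ s in 0..t, ‖z.1 s‖ ^ 2 ≤ Real.exp (2 * lam * T) *
      (‖ι (z.1 0)‖ ^ 2 + α⁻¹ * ∫ s in 0..t, ‖sourceMap ι A z s‖ ^ 2) := by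
  obtain ⟨hα, hlam, hA⟩ := hA
  set f := sourceMap ι A z with hf
  have hzc := continuous_C1 z
  have hfc : Continuous f := f.continuous
  set E : ℝ → ℝ := fun s => Real.exp (-(2 * lam) * s) with hE
  have hEc : Continuous E := by fun_prop
  have hEd : ∀ s, HasDerivAt E (E s * (-(2 * lam))) s := fun s => by
    simpa [hE] using ((hasDerivAt_id s).const_mul (-(2 * lam))).exp
  set g : ℝ → ℝ := fun s => E s * (α * ‖z.1 s‖ ^ 2 - α⁻¹ * ‖f s‖ ^ 2) with hg
  have hgc : Continuous g := by fun_prop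
  -- `Θ` is decreasing: the weight `E` absorbs the term `lam ‖ι z‖²` of Gårding's inequality, and
  -- Young's inequality bounds `2⟪f, z⟫` by `α⁻¹‖f‖² + α‖z‖²`, which uses up half of `2α‖z‖²`.
  -- Comparing `Θ t` with `Θ 0` is the estimate.
  set Θ : ℝ → ℝ := fun s => E s * ‖ι (z.1 s)‖ ^ 2 + ∫ r in 0..s, g r with hΘ
  have hΘd : ∀ s, HasDerivAt Θ (E s * (-(2 * lam)) * ‖ι (z.1 s)‖ ^ 2 +
      E s * (2 * ⟪ι (z.1 s), ι (deriv z.1 s)⟫) + g s) s := by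
    intro s
    have h1 := (ι.hasFDerivAt.comp_hasDerivAt s (hasDerivAt_C1 z s)).norm_sq
    exact ((hEd s).mul h1).add (intervalIntegral.integral_hasDerivAt_right
      (hgc.intervalIntegrable _ _) (hgc.stronglyMeasurableAtFilter _ _) hgc.continuousAt)
  have hanti : Antitone Θ := by
    refine antitone_of_deriv_nonpos (fun s => (hΘd s).differentiableAt) fun s => ?_
    rw [(hΘd s).deriv]
    have h1 : ⟪ι (z.1 s), ι (deriv z.1 s)⟫ = ⟪f s, z.1 s⟫ - ⟪A (z.1 s), z.1 s⟫ := by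
      have : f s = gram ι (deriv z.1 s) + A (z.1 s) := rfl
      rw [this, inner_add_left, inner_gram, real_inner_comm]; ring
    have h2 := hA (z.1 s)
    have h3 : ⟪f s, z.1 s⟫ ≤ ‖f s‖ * ‖z.1 s‖ := real_inner_le_norm _ _
    have h4 : 2 * (‖f s‖ * ‖z.1 s‖) ≤ α⁻¹ * ‖f s‖ ^ 2 + α * ‖z.1 s‖ ^ 2 := by
      have h5 : 0 ≤ α⁻¹ * (‖f s‖ - α * ‖z.1 s‖) ^ 2 := by positivity
      have h6 : α⁻¹ * (‖f s‖ - α * ‖z.1 s‖) ^ 2 =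
          α⁻¹ * ‖f s‖ ^ 2 - 2 * (‖f s‖ * ‖z.1 s‖) + α * ‖z.1 s‖ ^ 2 := by
        field_simp; ring
      linarith
    have h7 : -(2 * lam) * ‖ι (z.1 s)‖ ^ 2 + 2 * ⟪ι (z.1 s), ι (deriv z.1 s)⟫ +
        (α * ‖z.1 s‖ ^ 2 - α⁻¹ * ‖f s‖ ^ 2) ≤ 0 := by
      rw [h1]; linarith
    have h8 := mul_nonpos_of_nonneg_of_nonpos (Real.exp_pos (-(2 * lam) * s)).le h7
    simp only [hg, hE] at h8 ⊢
    linarith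
  have h0 := hanti ht.1
  have hsplit : ∫ r in 0..t, g r = (∫ r in 0..t, E r * (α * ‖z.1 r‖ ^ 2)) -
      ∫ r in 0..t, E r * (α⁻¹ * ‖f r‖ ^ 2) := by
    rw [← intervalIntegral.integral_sub]
    · simp only [hg, mul_sub]
    · exact (by fun_prop : Continuous fun r => E r * (α * ‖z.1 r‖ ^ 2)).intervalIntegrable _ _
    · exact (by fun_prop : Continuous fun r => E r * (α⁻¹ * ‖f r‖ ^ 2)).intervalIntegrable _ _
  have hEl : ∀ s ∈ Icc 0 t, Real.exp (-(2 * lam) * T) ≤ E s := fun s hs => by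
    simp only [hE]
    refine Real.exp_le_exp.2 ?_
    nlinarith [hs.1, hs.2, ht.1, ht.2]
  have hEu : ∀ s ∈ Icc 0 t, E s ≤ 1 := fun s hs => by
    simp only [hE]
    refine Real.exp_le_one_iff.2 ?_
    nlinarith [hs.1, hs.2, ht.1, ht.2]
  have hi1 : Real.exp (-(2 * lam) * T) * (α * ∫ r in 0..t, ‖z.1 r‖ ^ 2) ≤
      ∫ r in 0..t, E r * (α * ‖z.1 r‖ ^ 2) := by
    rw [← intervalIntegral.integral_const_mul, ← intervalIntegral.integral_const_mul]
    refine intervalIntegral.integral_mono_on ht.1 ?_ ?_ fun s hs => ?_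
    · exact (by fun_prop : Continuous fun r =>
        Real.exp (-(2 * lam) * T) * (α * ‖z.1 r‖ ^ 2)).intervalIntegrable _ _
    · exact (by fun_prop : Continuous fun r => E r * (α * ‖z.1 r‖ ^ 2)).intervalIntegrable _ _
    · exact mul_le_mul_of_nonneg_right (hEl s hs) (by positivity)
  have hi2 : (∫ r in 0..t, E r * (α⁻¹ * ‖f r‖ ^ 2)) ≤ α⁻¹ * ∫ r in 0..t, ‖f r‖ ^ 2 := by
    rw [← intervalIntegral.integral_const_mul]
    refine intervalIntegral.integral_mono_on ht.1 ?_ ?_ fun s hs => ?_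
    · exact (by fun_prop : Continuous fun r => E r * (α⁻¹ * ‖f r‖ ^ 2)).intervalIntegrable _ _
    · exact (by fun_prop : Continuous fun r => (α⁻¹ * ‖f r‖ ^ 2)).intervalIntegrable _ _
    · exact mul_le_of_le_one_left (by positivity) (hEu s hs)
  have hi3 := mul_le_mul_of_nonneg_right (hEl t (right_mem_Icc.2 ht.1))
    (sq_nonneg ‖ι (z.1 t)‖)
  have hE0 : E 0 = 1 := by simp [hE]
  simp only [hΘ, hsplit, intervalIntegral.integral_same, hE0] at h0
  have hfin : Real.exp (-(2 * lam) * T) *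
      (‖ι (z.1 t)‖ ^ 2 + α * ∫ s in 0..t, ‖z.1 s‖ ^ 2) ≤
      ‖ι (z.1 0)‖ ^ 2 + α⁻¹ * ∫ s in 0..t, ‖f s‖ ^ 2 := by
    rw [mul_add]; linarith
  have hmul := mul_le_mul_of_nonneg_left hfin (Real.exp_pos (2 * lam * T)).le
  rwa [← mul_assoc, ← Real.exp_add, show 2 * lam * T + -(2 * lam) * T = 0 by ring, Real.exp_zero,
    one_mul] at hmul

/-- The data of `C¹` functions are dense. -/
lemma denseRange_dataMap {T : ℝ} (hT : 0 < T) {ι : V →L[ℝ] H} (hι : DenseRange ι)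
    {A : V →L[ℝ] V} {α lam : ℝ} (hA : Garding ι A α lam) :
    DenseRange (dataMap hT.le ι A) := by
  have : (LinearMap.range (dataMap hT.le ι A)).topologicalClosure = ⊤ := by
    rw [Submodule.topologicalClosure_eq_top_iff, Submodule.eq_bot_iff]
    intro x hx
    have hx' : ∀ z : C1 V, ⟪ι (z.1 0), x.fst⟫ +
        ∫ t in Ioo 0 T, ⟪sourceMap ι A z t, x.snd t⟫ = 0 := by
      intro z
      have h1 := (Submodule.mem_orthogonal _ _).1 hx _ (LinearMap.mem_range_self _ z)
      rw [WithLp.prod_inner_apply] at h1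
      have h2 : ⟪(dataMap hT.le ι A z).snd, x.snd⟫ =
          ∫ t in Ioo 0 T, ⟪sourceMap ι A z t, x.snd t⟫ := by
        rw [dataMap_snd, L2.inner_def]
        refine integral_congr_ae ?_
        filter_upwards [coeFn_toTimeL2 hT.le (sourceMap ι A z)] with t ht
        rw [ht]
      rw [← h2]
      exact h1
    -- For `z = η w` with `η` supported in `(0,∞)` the initial value drops out, and orthogonality to
    -- the data of `z` is exactly the backward equation for `x.snd`.
    have hsnd : x.snd =ᵐ[timeMeasure T] 0 := by
      refine ae_eq_zero_of_backward hT hA ((Lp.memLp x.snd).integrable one_le_two) ?_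
      intro w η hη
      have hc : ContDiff ℝ 1 (fun t => η t • w) := (hη.1.of_le (by simp)).smul contDiff_const
      have h1 := hx' ⟨fun t => η t • w, mem_C1.2 hc⟩
      simp only [hη.eq_zero (t := 0) (by simp), zero_smul, map_zero, inner_zero_left,
        zero_add] at h1
      refine (integral_congr_ae (ae_of_all _ fun t => ?_)).trans h1
      have hd : deriv (fun t => η t • w) t = deriv η t • w :=
        (((hη.1.differentiable (by simp)) t).hasDerivAt.smul_const w).deriv
      simp only [sourceMap, LinearMap.coe_mk, AddHom.coe_mk, ContinuousMap.coe_mk, hd, map_smul,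
        inner_add_left, real_inner_smul_left, inner_gram]
    -- With `x.snd = 0`, constant functions `z = w` show that `x.fst` is orthogonal to the dense
    -- range of `ι`.
    have hfst : x.fst = 0 := by
      have h1 : ∀ w, ⟪ι w, x.fst⟫ = 0 := by
        intro w
        have h2 := hx' ⟨fun _ => w, mem_C1.2 contDiff_const⟩
        have h3 : ∫ t in Ioo 0 T, ⟪sourceMap ι A ⟨fun _ => w, mem_C1.2 contDiff_const⟩ t, x.snd t⟫ = 0 := by
          refine integral_eq_zero_of_ae ?_
          filter_upwards [hsnd] with t ht
          rw [ht]; simp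
        rw [h3, add_zero] at h2
        exact h2
      exact hι.eq_zero_of_inner_right ℝ h1
    have hsnd' : x.snd = 0 := by
      refine Lp.ext (hsnd.trans (Lp.coeFn_zero V 2 (timeMeasure T)).symm)
    have : x.ofLp = 0 := Prod.ext hfst hsnd'
    exact WithLp.ofLp_injective 2 this
  have h2 := (Submodule.dense_iff_topologicalClosure_eq_top).2 this
  exact h2

end Parabolic

/-! ### The solution operator of the linear equation. -/

section Parabolic

variable {V H : Type*} [NormedAddCommGroup V] [InnerProductSpace ℝ V]
  [NormedAddCommGroup H] [InnerProductSpace ℝ H]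

lemma norm_sq_toTimeL2 {T : ℝ} (hT : 0 ≤ T) (f : C(ℝ, V)) :
    ‖toTimeL2 hT f‖ ^ 2 = ∫ s in 0..T, ‖f s‖ ^ 2 := by
  rw [norm_sq_eq_integral, intervalIntegral.integral_of_le hT, integral_Ioc_eq_integral_Ioo]
  refine integral_congr_ae ?_
  filter_upwards [coeFn_toTimeL2 hT f] with t ht
  rw [ht]

variable [CompleteSpace V] [CompleteSpace H]

/-- The constant in the energy estimate. -/
def energyConst (α lam T : ℝ) : ℝ := Real.exp (2 * lam * T) * (1 + α⁻¹)

lemma energyConst_nonneg {α : ℝ} (hα : 0 < α) (lam T : ℝ) : 0 ≤ energyConst α lam T := by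
  unfold energyConst; positivity

/-- Only the source before time `t` enters. This causality is what makes the iteration of the
Volterra operator gain a factorial. For `t` outside `[0,T]` the state is continued by constants,
whence the projection. -/
lemma stateMap_estimate {T : ℝ} (hT : 0 ≤ T) {ι : V →L[ℝ] H} {A : V →L[ℝ] V} {α lam : ℝ}
    (hA : Garding ι A α lam) (z : C1 V) (t : ℝ) :
    ‖extendBCF hT (stateMap ι z) t‖ ^ 2 ≤ energyConst α lam T *
      (‖(dataMap hT ι A z).fst‖ ^ 2 +
        ∫ s in Iio t, ‖(dataMap hT ι A z).snd s‖ ^ 2 ∂(timeMeasure T)) := by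
  have hα := hA.1
  obtain ⟨τ, hτ⟩ : ∃ τ : ℝ, τ = (projIcc 0 T hT t).1 := ⟨_, rfl⟩
  have hτm : τ ∈ Icc 0 T := hτ ▸ (projIcc 0 T hT t).2
  have h1 := energy_estimate hA z hτm
  have h2 : 0 ≤ ∫ s in 0..τ, ‖z.1 s‖ ^ 2 :=
    intervalIntegral.integral_nonneg hτm.1 fun _ _ => by positivity
  have h3 : ∫ s in 0..τ, ‖sourceMap ι A z s‖ ^ 2 ≤
      ∫ s in Iio t, ‖(dataMap hT ι A z).snd s‖ ^ 2 ∂(timeMeasure T) := by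
    have e1 : ∫ s in Iio t, ‖(dataMap hT ι A z).snd s‖ ^ 2 ∂(timeMeasure T) =
        ∫ s in Iio t ∩ Ioo 0 T, ‖sourceMap ι A z s‖ ^ 2 := by
      rw [← Measure.restrict_restrict measurableSet_Iio]
      refine integral_congr_ae (ae_restrict_of_ae ?_)
      filter_upwards [coeFn_toTimeL2 hT (sourceMap ι A z)] with s hs
      rw [dataMap_snd, hs]
    rw [e1, intervalIntegral.integral_of_le hτm.1, integral_Ioc_eq_integral_Ioo]
    refine setIntegral_mono_set ?_ (ae_of_all _ fun s => by positivity)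
      (LE.le.eventuallyLE fun s hs => ?_)
    · refine IntegrableOn.mono_set (t := Icc 0 T) ?_ (inter_subset_right.trans Ioo_subset_Icc_self)
      have := (sourceMap ι A z).continuous
      exact (by fun_prop : Continuous fun s => ‖sourceMap ι A z s‖ ^ 2).continuousOn.integrableOn_Icc
    · refine ⟨?_, hs.1, hs.2.trans_le hτm.2⟩
      have h4 : τ = max 0 (min T t) := hτ
      have h5 : 0 < τ := hs.1.trans hs.2
      have h6 := hs.2
      rw [h4] at h5 h6
      rcases lt_max_iff.1 h6 with h7 | h7
      · exact absurd hs.1 (not_lt.2 h7.le)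
      · exact lt_of_lt_of_le h7 (min_le_right _ _)
  have h4 : 0 ≤ ∫ s in 0..τ, ‖sourceMap ι A z s‖ ^ 2 :=
    intervalIntegral.integral_nonneg hτm.1 fun _ _ => by positivity
  rw [dataMap_fst]
  change ‖ι (z.1 (projIcc 0 T hT t).1)‖ ^ 2 ≤ _
  rw [← hτ]
  have hαi : 0 < α⁻¹ := inv_pos.2 hα
  unfold energyConst
  rw [mul_assoc]
  have h5 : ‖ι (z.1 τ)‖ ^ 2 ≤ Real.exp (2 * lam * T) *
      (‖ι (z.1 0)‖ ^ 2 + α⁻¹ * ∫ s in 0..τ, ‖sourceMap ι A z s‖ ^ 2) := by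
    have := mul_nonneg hα.le h2
    linarith
  refine h5.trans (mul_le_mul_of_nonneg_left ?_ (Real.exp_pos _).le)
  have h6 := sq_nonneg ‖ι (z.1 0)‖
  have h7 := mul_le_mul_of_nonneg_left h3 hαi.le
  have h8 := mul_nonneg hαi.le h6
  nlinarith

lemma dataMap_norm_sq {T : ℝ} (hT : 0 ≤ T) (ι : V →L[ℝ] H) (A : V →L[ℝ] V) (z : C1 V) :
    ‖dataMap hT ι A z‖ ^ 2 = ‖ι (z.1 0)‖ ^ 2 + ∫ s in 0..T, ‖sourceMap ι A z s‖ ^ 2 := by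
  rw [WithLp.prod_norm_sq_eq_of_L2, ← norm_sq_toTimeL2 hT]
  rfl

/-- This bound is the condition under which the map from data to solutions extends to the closure of
the data. -/
lemma solMap_bound {T : ℝ} (hT : 0 ≤ T) {ι : V →L[ℝ] H} {A : V →L[ℝ] V} {α lam : ℝ}
    (hA : Garding ι A α lam) : ∃ C, ∀ z : C1 V, ‖solMap hT ι z‖ ≤ C * ‖dataMap hT ι A z‖ := by
  have hα := hA.1
  have hαi : 0 < α⁻¹ := inv_pos.2 hα
  set M := energyConst α lam T with hM
  have hM0 : 0 ≤ M := energyConst_nonneg hα _ _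
  -- The squared supremum norm costs `M`, the squared norm in L²(0,T; V) costs `M α⁻¹`; the constant
  -- covers both.
  refine ⟨√(M * (1 + α⁻¹)), fun z => ?_⟩
  have hmain : ∀ t ∈ Icc 0 T, ‖ι (z.1 t)‖ ^ 2 + α * ∫ s in 0..t, ‖z.1 s‖ ^ 2 ≤
      M * ‖dataMap hT ι A z‖ ^ 2 := by
    intro t ht
    refine (energy_estimate hA z ht).trans ?_
    rw [hM, energyConst, mul_assoc (Real.exp _), dataMap_norm_sq]
    refine mul_le_mul_of_nonneg_left ?_ (Real.exp_pos _).le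
    have hc : Continuous fun s => ‖sourceMap ι A z s‖ ^ 2 := by
      have := (sourceMap ι A z).continuous
      fun_prop
    have h1 : ∫ s in 0..t, ‖sourceMap ι A z s‖ ^ 2 ≤ ∫ s in 0..T, ‖sourceMap ι A z s‖ ^ 2 :=
      intervalIntegral.integral_mono_interval le_rfl ht.1 ht.2
        (ae_of_all _ fun s => by positivity) (hc.intervalIntegrable _ _)
    have h2 : 0 ≤ ∫ s in 0..T, ‖sourceMap ι A z s‖ ^ 2 :=
      intervalIntegral.integral_nonneg hT fun _ _ => by positivity
    have h6 := sq_nonneg ‖ι (z.1 0)‖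
    have h7 := mul_le_mul_of_nonneg_left h1 hαi.le
    have h8 := mul_nonneg hαi.le h6
    nlinarith
  have hbound : ∀ x : ℝ, 0 ≤ x → x ^ 2 ≤ M * (1 + α⁻¹) * ‖dataMap hT ι A z‖ ^ 2 →
      x ≤ √(M * (1 + α⁻¹)) * ‖dataMap hT ι A z‖ := by
    intro x hx h
    refine (pow_le_pow_iff_left₀ hx (by positivity) two_ne_zero).1 ?_
    rwa [mul_pow, Real.sq_sqrt (by positivity)]
  have hD := mul_nonneg hM0 (sq_nonneg ‖dataMap hT ι A z‖)
  rw [Prod.norm_def]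
  refine max_le ?_ ?_
  · refine (BoundedContinuousFunction.norm_le (by positivity)).2 fun t => ?_
    refine hbound _ (norm_nonneg _) ?_
    have hτm := (projIcc 0 T hT t).2
    have h1 := hmain _ hτm
    have h2 : 0 ≤ α * ∫ s in 0..(projIcc 0 T hT t : ℝ), ‖z.1 s‖ ^ 2 :=
      mul_nonneg hα.le (intervalIntegral.integral_nonneg hτm.1 fun _ _ => by positivity)
    change ‖ι (z.1 (projIcc 0 T hT t))‖ ^ 2 ≤ _
    nlinarith
  · refine hbound _ (norm_nonneg _) ?_
    change ‖toTimeL2 hT (valMap V z)‖ ^ 2 ≤ _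
    rw [norm_sq_toTimeL2]
    change ∫ s in 0..T, ‖z.1 s‖ ^ 2 ≤ _
    have h1 := hmain T (right_mem_Icc.2 hT)
    have h2 := sq_nonneg ‖ι (z.1 T)‖
    have h3 : α * ∫ s in 0..T, ‖z.1 s‖ ^ 2 ≤ M * ‖dataMap hT ι A z‖ ^ 2 := by linarith
    have h4 := mul_le_mul_of_nonneg_left h3 hαi.le
    rw [← mul_assoc, inv_mul_cancel₀ hα.ne', one_mul] at h4
    nlinarith

/-- The solution operator of the equation `z' + A z = f`, `z(0) = z₀`. It yields the solution as
a continuous function with values in `H` and as an element of `L²(0,T; V)`. -/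
def solOp {T : ℝ} (hT : 0 ≤ T) (ι : V →L[ℝ] H) (A : V →L[ℝ] V) :
    DataSpace V H T →L[ℝ] BoundedContinuousFunction ℝ H × Lp V 2 (timeMeasure T) :=
  (solMap hT ι).extendOfNorm (dataMap hT ι A)

variable {T : ℝ} {ι : V →L[ℝ] H} {A : V →L[ℝ] V} {α lam : ℝ}

lemma solOp_dataMap (hT : 0 < T) (hι : DenseRange ι) (hA : Garding ι A α lam) (z : C1 V) :
    solOp hT.le ι A (dataMap hT.le ι A z) = solMap hT.le ι z :=
  LinearMap.extendOfNorm_eq (denseRange_dataMap hT hι hA) (solMap_bound hT.le hA) z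

/-- Read in L²(0,T; H), the identity is a closed condition on `d`, and it is evident for the data of
C¹ functions. The lemmas up to `solOp_weak` follow the same density argument. -/
lemma solOp_coe_ae (hT : 0 < T) (hι : DenseRange ι) (hA : Garding ι A α lam)
    (d : DataSpace V H T) :
    (solOp hT.le ι A d).1 =ᵐ[timeMeasure T] fun t => ι ((solOp hT.le ι A d).2 t) := by
  have key : BoundedContinuousFunction.toLp 2 (timeMeasure T) ℝ (solOp hT.le ι A d).1 =
      ι.compLpL 2 (timeMeasure T) (solOp hT.le ι A d).2 := by
    refine (denseRange_dataMap hT hι hA).induction_on (p := fun d =>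
      BoundedContinuousFunction.toLp 2 (timeMeasure T) ℝ (solOp hT.le ι A d).1 =
      ι.compLpL 2 (timeMeasure T) (solOp hT.le ι A d).2) d ?_ fun z => ?_
    · exact isClosed_eq (by fun_prop) (by fun_prop)
    · rw [solOp_dataMap hT hι hA]
      refine Lp.ext ?_
      filter_upwards [coeFn_toTimeL2 hT.le (stateMap ι z), coeFn_toTimeL2 hT.le (valMap V z),
        ι.coeFn_compLpL (p := 2) (μ := timeMeasure T) (toTimeL2 hT.le (valMap V z))]
        with t h1 h2 h3
      exact (h1.trans (h3.trans (congrArg ι h2)).symm)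
  filter_upwards [BoundedContinuousFunction.coeFn_toLp 2 (timeMeasure T) ℝ (solOp hT.le ι A d).1,
    ι.coeFn_compLpL (p := 2) (μ := timeMeasure T) (solOp hT.le ι A d).2] with t h1 h2
  rw [← h1, key, h2]

lemma solOp_zero (hT : 0 < T) (hι : DenseRange ι) (hA : Garding ι A α lam)
    (d : DataSpace V H T) : (solOp hT.le ι A d).1 0 = d.fst := by
  refine (denseRange_dataMap hT hι hA).induction_on
    (p := fun d => (solOp hT.le ι A d).1 0 = d.fst) d ?_ fun z => ?_
  · refine isClosed_eq ?_ ?_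
    · exact ((BoundedContinuousFunction.evalCLM ℝ (0 : ℝ)).continuous).comp
        (solOp hT.le ι A).continuous.fst
    · exact (WithLp.prod_continuous_ofLp 2 _ _).fst
  · rw [solOp_dataMap hT hι hA]
    exact extendBCF_of_mem hT.le _ (left_mem_Icc.2 hT.le)

lemma solOp_estimate (hT : 0 < T) (hι : DenseRange ι) (hA : Garding ι A α lam)
    (d : DataSpace V H T) (t : ℝ) :
    ‖(solOp hT.le ι A d).1 t‖ ^ 2 ≤ energyConst α lam T *
      (‖d.fst‖ ^ 2 + ∫ s in Iio t, ‖d.snd s‖ ^ 2 ∂(timeMeasure T)) := by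
  refine (denseRange_dataMap hT hι hA).induction_on (p := fun d =>
    ‖(solOp hT.le ι A d).1 t‖ ^ 2 ≤ energyConst α lam T *
      (‖d.fst‖ ^ 2 + ∫ s in Iio t, ‖d.snd s‖ ^ 2 ∂(timeMeasure T))) d ?_ fun z => ?_
  · have e : ∀ d : DataSpace V H T, ∫ s in Iio t, ‖d.snd s‖ ^ 2 ∂(timeMeasure T) =
        ‖LpToLpRestrictCLM ℝ V ℝ (timeMeasure T) 2 (Iio t) d.snd‖ ^ 2 := by
      intro d
      rw [norm_sq_eq_integral]
      refine integral_congr_ae ?_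
      filter_upwards [LpToLpRestrictCLM_coeFn (𝕜 := ℝ) (Iio t) d.snd] with s hs
      rw [hs]
    simp only [e]
    have h1 : Continuous fun d : DataSpace V H T => (solOp hT.le ι A d).1 t :=
      ((BoundedContinuousFunction.evalCLM ℝ t).continuous).comp (solOp hT.le ι A).continuous.fst
    have h2 : Continuous fun d : DataSpace V H T => d.fst :=
      (WithLp.prod_continuous_ofLp 2 _ _).fst
    have h3 : Continuous fun d : DataSpace V H T =>
        LpToLpRestrictCLM ℝ V ℝ (timeMeasure T) 2 (Iio t) d.snd :=
      (ContinuousLinearMap.continuous _).comp (WithLp.prod_continuous_ofLp 2 _ _).snd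
    exact isClosed_le (by fun_prop) (by fun_prop)
  · rw [solOp_dataMap hT hι hA]
    exact stateMap_estimate hT.le hA z t

/-- The weak form of the equation. -/
lemma solOp_weak (hT : 0 < T) (hι : DenseRange ι) (hA : Garding ι A α lam)
    (d : DataSpace V H T) (φ : V) {η : ℝ → ℝ} (hη : IsTestFunction (Ioo 0 T) η) :
    ∫ t in Ioo 0 T, ⟪ι ((solOp hT.le ι A d).2 t), ι φ⟫ * deriv η t =
      -∫ t in Ioo 0 T, ⟪d.snd t - A ((solOp hT.le ι A d).2 t), φ⟫ * η t := by
  -- With the test functions packaged as elements of L²(0,T; V), both sides are inner products and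
  -- hence continuous in `d`. For C¹ functions the identity is integration by parts, as `η` vanishes
  -- at `0` and `T`.
  set g₁ : C(ℝ, V) := ⟨fun t => deriv η t • gram ι φ, by
    have := hη.1.continuous_deriv (by simp); fun_prop⟩ with hg₁
  set g₂ : C(ℝ, V) := ⟨fun t => η t • φ, by
    have := hη.1.continuous; fun_prop⟩ with hg₂
  have e1 : ∀ d : DataSpace V H T,
      ∫ t in Ioo 0 T, ⟪ι ((solOp hT.le ι A d).2 t), ι φ⟫ * deriv η t =
        ⟪(solOp hT.le ι A d).2, toTimeL2 hT.le g₁⟫ := by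
    intro d
    rw [L2.inner_def]
    refine integral_congr_ae ?_
    filter_upwards [coeFn_toTimeL2 hT.le g₁] with t ht
    rw [ht]
    simp only [hg₁, ContinuousMap.coe_mk, real_inner_smul_right, real_inner_comm (gram ι φ),
      inner_gram]
    rw [real_inner_comm, mul_comm]
  have e2 : ∀ d : DataSpace V H T,
      ∫ t in Ioo 0 T, ⟪d.snd t - A ((solOp hT.le ι A d).2 t), φ⟫ * η t =
        ⟪d.snd - A.compLpL 2 (timeMeasure T) (solOp hT.le ι A d).2, toTimeL2 hT.le g₂⟫ := by
    intro d
    rw [L2.inner_def]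
    refine integral_congr_ae ?_
    filter_upwards [coeFn_toTimeL2 hT.le g₂, Lp.coeFn_sub d.snd
      (A.compLpL 2 (timeMeasure T) (solOp hT.le ι A d).2),
      A.coeFn_compLpL (p := 2) (μ := timeMeasure T) (solOp hT.le ι A d).2] with t h1 h2 h3
    rw [h1, h2, Pi.sub_apply, h3]
    simp only [hg₂, ContinuousMap.coe_mk, real_inner_smul_right]
    rw [mul_comm]
  rw [e1, e2]
  refine (denseRange_dataMap hT hι hA).induction_on (p := fun d =>
    ⟪(solOp hT.le ι A d).2, toTimeL2 hT.le g₁⟫ =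
      -⟪d.snd - A.compLpL 2 (timeMeasure T) (solOp hT.le ι A d).2, toTimeL2 hT.le g₂⟫)
    d ?_ fun z => ?_
  · have h3 : Continuous fun d : DataSpace V H T => d.snd :=
      (WithLp.prod_continuous_ofLp 2 _ _).snd
    exact isClosed_eq (by fun_prop) (by fun_prop)
  · rw [← e1, ← e2, solOp_dataMap hT hι hA]
    have hz := coeFn_toTimeL2 hT.le (valMap V z)
    have h1 : ∫ t in Ioo 0 T, ⟪ι ((solMap hT.le ι z).2 t), ι φ⟫ * deriv η t =
        ∫ t in 0..T, ⟪ι (z.1 t), ι φ⟫ * deriv η t := by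
      rw [intervalIntegral.integral_of_le hT.le, integral_Ioc_eq_integral_Ioo]
      refine integral_congr_ae ?_
      filter_upwards [hz] with t ht
      change ⟪ι (toTimeL2 hT.le (valMap V z) t), ι φ⟫ * deriv η t = _
      rw [ht]
      rfl
    have h2 : ∫ t in Ioo 0 T, ⟪(dataMap hT.le ι A z).snd t - A ((solMap hT.le ι z).2 t), φ⟫ * η t
        = ∫ t in 0..T, ⟪ι (deriv z.1 t), ι φ⟫ * η t := by
      rw [intervalIntegral.integral_of_le hT.le, integral_Ioc_eq_integral_Ioo]
      refine integral_congr_ae ?_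
      filter_upwards [hz, coeFn_toTimeL2 hT.le (sourceMap ι A z)] with t ht ht'
      rw [dataMap_snd, ht']
      change ⟪_ - A (toTimeL2 hT.le (valMap V z) t), φ⟫ * η t = _
      rw [ht, ← inner_gram]
      simp [sourceMap, valMap]
    rw [h1, h2]
    have hc : Continuous fun t => ⟪ι (deriv z.1 t), ι φ⟫ := by
      have := continuous_deriv_C1 z; fun_prop
    rw [intervalIntegral.integral_mul_deriv_eq_deriv_mul
      (u := fun t => ⟪ι (z.1 t), ι φ⟫) (u' := fun t => ⟪ι (deriv z.1 t), ι φ⟫) (v := η)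
      (v' := deriv η), hη.eq_zero (t := 0) (by simp), hη.eq_zero (t := T) (by simp)]
    · simp
    · intro t _
      simpa using (ι.hasFDerivAt.comp_hasDerivAt t (hasDerivAt_C1 z t)).inner ℝ
        (hasDerivAt_const t (ι φ))
    · intro t _
      exact ((hη.1.differentiable (by simp)) t).hasDerivAt
    · exact hc.intervalIntegrable _ _
    · exact (hη.1.continuous_deriv (by simp)).intervalIntegrable _ _

end Parabolic

/-! ### Uniqueness of weak solutions: test functions not vanishing at 0, and reversal of time. -/

section Parabolic

/-- A smooth function that vanishes on `(-∞,1]` and equals `1` on `[2,∞)`. -/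
def cutoff (t : ℝ) : ℝ := Real.smoothTransition (t - 1)

lemma contDiff_cutoff : ContDiff ℝ ∞ cutoff :=
  Real.smoothTransition.contDiff.comp (contDiff_id.sub contDiff_const)

lemma cutoff_of_le {t : ℝ} (ht : t ≤ 1) : cutoff t = 0 :=
  Real.smoothTransition.zero_of_nonpos (by linarith)

lemma cutoff_of_ge {t : ℝ} (ht : 2 ≤ t) : cutoff t = 1 :=
  Real.smoothTransition.one_of_one_le (by linarith)

lemma norm_cutoff_le (t : ℝ) : ‖cutoff t‖ ≤ 1 := by
  rw [Real.norm_eq_abs, cutoff, abs_of_nonneg (Real.smoothTransition.nonneg _)]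
  exact Real.smoothTransition.le_one _

lemma deriv_cutoff_of_lt {t : ℝ} (ht : t < 1) : deriv cutoff t = 0 := by
  have : cutoff =ᶠ[𝓝 t] fun _ => 0 := by
    filter_upwards [Iio_mem_nhds ht] with s hs using cutoff_of_le (mem_Iio.1 hs).le
  rw [this.deriv_eq, deriv_const]

lemma deriv_cutoff_of_gt {t : ℝ} (ht : 2 < t) : deriv cutoff t = 0 := by
  have : cutoff =ᶠ[𝓝 t] fun _ => 1 := by
    filter_upwards [Ioi_mem_nhds ht] with s hs using cutoff_of_ge (mem_Ioi.1 hs).le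
  rw [this.deriv_eq, deriv_const]

lemma continuous_deriv_cutoff : Continuous (deriv cutoff) :=
  contDiff_cutoff.continuous_deriv (by simp)

lemma hasCompactSupport_deriv_cutoff : HasCompactSupport (deriv cutoff) := by
  refine HasCompactSupport.intro (K := Icc 1 2) isCompact_Icc fun t ht => ?_
  rw [mem_Icc, not_and_or, not_le, not_le] at ht
  exact ht.elim deriv_cutoff_of_lt deriv_cutoff_of_gt

lemma IsTestFunction.cutoff_mul {T : ℝ} {η : ℝ → ℝ} (hη : IsTestFunction (Iio T) η) {N : ℝ}
    (hN : 0 < N) : IsTestFunction (Ioo 0 T) (fun t => cutoff (N * t) * η t) := by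
  refine ⟨(contDiff_cutoff.comp (contDiff_const.mul contDiff_id)).mul hη.1, hη.2.1.mul_left, ?_⟩
  intro t ht
  have h1 : t ∈ Ici N⁻¹ := by
    refine closure_minimal (fun s hs => ?_) isClosed_Ici ht
    by_contra hcon
    refine hs ?_
    have : N * s ≤ 1 := by
      rw [mem_Ici, not_le] at hcon
      have := mul_le_mul_of_nonneg_left hcon.le hN.le
      rwa [mul_inv_cancel₀ hN.ne'] at this
    simp [cutoff_of_le this]
  refine ⟨(inv_pos.2 hN).trans_le h1, hη.2.2 ?_⟩
  exact tsupport_mul_subset_right ht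

/-- With `N = n + 1`, the derivative of `cutoff (N t)` lives on `[1/N, 2/N]` and has size of order
`N`. The substitution `s = N t` removes the factor `N` and replaces `m(t)` by `m(s/N)`, which tends
to `m(0) = 0`. -/
lemma tendsto_integral_deriv_cutoff {T : ℝ} {m : ℝ → ℝ} (hm : Continuous m) (hm0 : m 0 = 0) {M : ℝ}
    (hM : ∀ t, ‖m t‖ ≤ M) {η : ℝ → ℝ} (hη : IsTestFunction (Iio T) η) :
    Tendsto (fun n : ℕ => ∫ t in Ioo 0 T,
      m t * (((n : ℝ) + 1) * deriv cutoff (((n : ℝ) + 1) * t) * η t)) atTop (𝓝 0) := by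
  obtain ⟨C, hC⟩ := hη.2.1.exists_bound_of_continuous hη.1.continuous
  have e : ∀ n : ℕ, ∫ t in Ioo 0 T,
      m t * (((n : ℝ) + 1) * deriv cutoff (((n : ℝ) + 1) * t) * η t) =
      ∫ s, m (s / ((n : ℝ) + 1)) * deriv cutoff s * η (s / ((n : ℝ) + 1)) := by
    intro n
    have hN : (0 : ℝ) < (n : ℝ) + 1 := by positivity
    set N : ℝ := (n : ℝ) + 1
    have h1 := Measure.integral_comp_mul_left
      (fun s => m (s / N) * deriv cutoff s * η (s / N)) N
    rw [abs_of_pos (inv_pos.2 hN), smul_eq_mul] at h1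
    have h2 : ∫ s, m (s / N) * deriv cutoff s * η (s / N) =
        ∫ t, m t * (N * deriv cutoff (N * t) * η t) := by
      rw [← mul_right_inj' (inv_pos.2 hN).ne', ← h1, ← integral_const_mul]
      refine integral_congr_ae (ae_of_all _ fun t => ?_)
      simp only [mul_div_cancel_left₀ t hN.ne']
      field_simp
    rw [h2]
    refine setIntegral_eq_integral_of_forall_compl_eq_zero fun t ht => ?_
    rw [mem_Ioo, not_and_or, not_lt, not_lt] at ht
    rcases ht with ht | ht
    · rw [deriv_cutoff_of_lt (lt_of_le_of_lt (mul_nonpos_of_nonneg_of_nonpos hN.le ht) one_pos)]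
      simp
    · rw [hη.eq_zero (by simpa using ht)]; simp
  simp only [e]
  have hlim : Tendsto (fun n : ℕ => ∫ s,
      m (s / ((n : ℝ) + 1)) * deriv cutoff s * η (s / ((n : ℝ) + 1))) atTop
      (𝓝 (∫ _ : ℝ, (0 : ℝ))) := by
    refine tendsto_integral_of_dominated_convergence (fun s => M * ‖deriv cutoff s‖ * C) ?_ ?_ ?_ ?_
    · intro n
      have h1 := hη.1.continuous
      have h2 := continuous_deriv_cutoff
      have : Continuous fun s : ℝ =>
          m (s / ((n : ℝ) + 1)) * deriv cutoff s * η (s / ((n : ℝ) + 1)) := by fun_prop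
      exact this.aestronglyMeasurable
    · have h1 : Integrable (deriv cutoff) :=
        continuous_deriv_cutoff.integrable_of_hasCompactSupport hasCompactSupport_deriv_cutoff
      exact (h1.norm.const_mul M).mul_const C
    · intro n
      refine ae_of_all _ fun s => ?_
      rw [norm_mul, norm_mul]
      have hM0 : 0 ≤ M := (norm_nonneg _).trans (hM 0)
      gcongr
      · exact hM _
      · exact hC _
    · refine ae_of_all _ fun s => ?_
      have hs : Tendsto (fun n : ℕ => s / ((n : ℝ) + 1)) atTop (𝓝 0) := by
        simpa using (tendsto_one_div_add_atTop_nhds_zero_nat (𝕜 := ℝ)).const_mul s |>.congr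
          fun n => by ring
      have h1 := ((hm.tendsto 0).comp hs).mul_const (deriv cutoff s) |>.mul
        ((hη.1.continuous.tendsto 0).comp hs)
      simpa [hm0] using h1
  simpa using hlim

/-- The weak equation for `m` with `m(0) = 0` may be tested with functions that do not vanish
at `0`. -/
lemma weak_eq_of_eq_zero {T : ℝ} {m g : ℝ → ℝ} (hm : Continuous m) (hm0 : m 0 = 0) {M : ℝ}
    (hM : ∀ t, ‖m t‖ ≤ M) (hg : Integrable g (timeMeasure T))
    (h : ∀ η : ℝ → ℝ, IsTestFunction (Ioo 0 T) η →
      ∫ t in Ioo 0 T, m t * deriv η t = ∫ t in Ioo 0 T, g t * η t)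
    {η : ℝ → ℝ} (hη : IsTestFunction (Iio T) η) :
    ∫ t in Ioo 0 T, m t * deriv η t = ∫ t in Ioo 0 T, g t * η t := by
  have hmi : Integrable m (timeMeasure T) :=
    Integrable.of_bound hm.aestronglyMeasurable M (ae_of_all _ hM)
  have hcut : ∀ t ∈ Ioo 0 T, Tendsto (fun n : ℕ => cutoff (((n : ℝ) + 1) * t)) atTop (𝓝 1) := by
    intro t ht
    refine tendsto_const_nhds.congr' ?_
    filter_upwards [eventually_ge_atTop ⌈2 / t⌉₊] with n hn
    rw [cutoff_of_ge]
    have h1 : 2 / t ≤ n := (Nat.le_ceil _).trans (by exact_mod_cast hn)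
    rw [div_le_iff₀ ht.1] at h1
    nlinarith [ht.1]
  have hlim : ∀ (f k : ℝ → ℝ), Integrable f (timeMeasure T) → Continuous k →
      (∃ C, ∀ x, ‖k x‖ ≤ C) →
      Tendsto (fun n : ℕ => ∫ t in Ioo 0 T, f t * (cutoff (((n : ℝ) + 1) * t) * k t)) atTop
        (𝓝 (∫ t in Ioo 0 T, f t * k t)) := by
    rintro f k hf hk ⟨C, hC⟩
    refine tendsto_integral_of_dominated_convergence (fun s => ‖f s‖ * C) ?_ ?_ ?_ ?_
    · intro n
      have := contDiff_cutoff.continuous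
      have : Continuous fun t => cutoff (((n : ℝ) + 1) * t) * k t := by fun_prop
      exact hf.aestronglyMeasurable.mul this.aestronglyMeasurable
    · exact hf.norm.mul_const C
    · intro n
      refine ae_of_all _ fun s => ?_
      rw [norm_mul, norm_mul]
      gcongr
      calc _ ≤ 1 * ‖k s‖ := by gcongr; exact norm_cutoff_le _
        _ ≤ C := by rw [one_mul]; exact hC s
    · refine (ae_restrict_iff' measurableSet_Ioo).2 (ae_of_all _ fun t ht => ?_)
      simpa using ((hcut t ht).mul_const (k t)).const_mul (f t)
  have h1 := hlim g η hg hη.1.continuous (hη.2.1.exists_bound_of_continuous hη.1.continuous)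
  have h2 := hlim m (deriv η) hmi (hη.1.continuous_deriv (by simp)) hη.deriv_bound
  have h3 := (tendsto_integral_deriv_cutoff hm hm0 hM hη).add h2
  rw [zero_add] at h3
  -- Test with `cutoff ((n + 1) t) η(t)`. The product rule splits the left side into the term where
  -- the cutoff is differentiated, which vanishes in the limit, and one that converges to `∫ m η'`.
  refine tendsto_nhds_unique h3 (h1.congr fun n => ?_)
  have hN : (0 : ℝ) < (n : ℝ) + 1 := by positivity
  rw [← h _ (hη.cutoff_mul hN), ← integral_add]
  · refine integral_congr_ae (ae_of_all _ fun t => ?_)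
    have hd : HasDerivAt (fun t => cutoff (((n : ℝ) + 1) * t) * η t)
        (deriv cutoff (((n : ℝ) + 1) * t) * ((n : ℝ) + 1) * η t +
          cutoff (((n : ℝ) + 1) * t) * deriv η t) t := by
      have d1 : HasDerivAt (fun t => cutoff (((n : ℝ) + 1) * t))
          (deriv cutoff (((n : ℝ) + 1) * t) * ((n : ℝ) + 1)) t := by
        refine HasDerivAt.comp (h₂ := cutoff) t
          ((contDiff_cutoff.differentiable (by simp)) _).hasDerivAt ?_
        simpa using (hasDerivAt_id t).const_mul ((n : ℝ) + 1)
      exact d1.mul ((hη.1.differentiable (by simp)) t).hasDerivAt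
    simp only [hd.deriv]
    ring
  · have := continuous_deriv_cutoff
    have h4 := hη.1.continuous
    have : Continuous fun t =>
        m t * (((n : ℝ) + 1) * deriv cutoff (((n : ℝ) + 1) * t) * η t) := by fun_prop
    exact (this.continuousOn.integrableOn_Icc (a := 0) (b := T)).mono_set Ioo_subset_Icc_self
  · have := contDiff_cutoff.continuous
    have h4 := hη.1.continuous_deriv (by simp)
    have : Continuous fun t =>
        m t * (cutoff (((n : ℝ) + 1) * t) * deriv η t) := by fun_prop
    exact (this.continuousOn.integrableOn_Icc (a := 0) (b := T)).mono_set Ioo_subset_Icc_self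

variable {V H : Type*} [NormedAddCommGroup V] [InnerProductSpace ℝ V]
  [NormedAddCommGroup H] [InnerProductSpace ℝ H] [CompleteSpace V]

/-- A weak solution of the homogeneous equation with initial value `0` vanishes. -/
lemma ae_eq_zero_of_weak {T : ℝ} (hT : 0 < T) {ι : V →L[ℝ] H} {A : V →L[ℝ] V} {α lam : ℝ}
    (hA : Garding ι A α lam) {z : ℝ → V} (hz : Integrable z (timeMeasure T)) {y : ℝ → H}
    (hy : ContinuousOn y (Icc 0 T)) (hyz : ∀ᵐ t ∂(timeMeasure T), y t = ι (z t)) (hy0 : y 0 = 0)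
    (h : ∀ φ : V, ∀ η : ℝ → ℝ, IsTestFunction (Ioo 0 T) η →
      ∫ t in Ioo 0 T, ⟪ι (z t), ι φ⟫ * deriv η t = ∫ t in Ioo 0 T, ⟪A (z t), φ⟫ * η t) :
    z =ᵐ[timeMeasure T] 0 := by
  -- Time reversal turns the forward equation for `A` into the backward equation for its adjoint,
  -- which has the same quadratic form. The initial value `0` becomes the final value `0`, that is,
  -- freedom to test with functions not vanishing at that end.
  have hA' : Garding ι (ContinuousLinearMap.adjoint A) α lam := by
    refine ⟨hA.1, hA.2.1, fun v => ?_⟩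
    rw [ContinuousLinearMap.adjoint_inner_left, real_inner_comm]
    exact hA.2.2 v
  have hmp : MeasurePreserving (fun s => T - s) (timeMeasure T) (timeMeasure T) := by
    have := (Measure.measurePreserving_sub_left volume T).restrict_preimage
      (measurableSet_Ioo (a := (0 : ℝ)) (b := T))
    simpa using this
  have hme : MeasurableEmbedding (fun s : ℝ => T - s) :=
    (Homeomorph.subLeft T).measurableEmbedding
  have hweak : ∀ φ : V, ∀ η : ℝ → ℝ, IsTestFunction (Iio T) η →
      ∫ t in Ioo 0 T, ⟪ι (z t), ι φ⟫ * deriv η t = ∫ t in Ioo 0 T, ⟪A (z t), φ⟫ * η t := by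
    intro φ η hη
    set m : ℝ → ℝ := fun t => ⟪y (projIcc 0 T hT.le t), ι φ⟫ with hm
    have hmc : Continuous m := by
      have h1 : Continuous (fun t => y (projIcc 0 T hT.le t)) :=
        (hy.domRestrict.comp continuous_projIcc)
      exact h1.inner continuous_const
    have hmz : ∀ᵐ t ∂(timeMeasure T), ⟪ι (z t), ι φ⟫ = m t := by
      filter_upwards [hyz, ae_restrict_mem measurableSet_Ioo] with t ht ht'
      rw [← ht, hm]
      simp only [projIcc_of_mem hT.le (Ioo_subset_Icc_self ht')]
    obtain ⟨M, hM⟩ : ∃ M, ∀ t, ‖m t‖ ≤ M := by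
      obtain ⟨M, hM⟩ := isCompact_Icc.exists_bound_of_continuousOn hy
      refine ⟨M * ‖ι φ‖, fun t => (norm_inner_le_norm _ _).trans ?_⟩
      gcongr
      exact hM _ (projIcc 0 T hT.le t).2
    have hcongr : ∀ k : ℝ → ℝ, ∫ t in Ioo 0 T, ⟪ι (z t), ι φ⟫ * k t =
        ∫ t in Ioo 0 T, m t * k t := fun k => by
      refine integral_congr_ae ?_
      filter_upwards [hmz] with t ht
      rw [ht]
    rw [hcongr]
    refine weak_eq_of_eq_zero hmc ?_ hM ?_ (fun η hη => ?_) hη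
    · simp [hm, hy0]
    · have := ((innerSL ℝ φ) ∘L A).integrable_comp hz
      refine this.congr (ae_of_all _ fun t => ?_)
      simp [real_inner_comm]
    · rw [← hcongr]; exact h φ η hη
  have hcore : (fun s => z (T - s)) =ᵐ[timeMeasure T] 0 := by
    refine ae_eq_zero_of_backward hT hA' ((hmp.integrable_comp_emb hme).2 hz) ?_
    intro w η hη
    have e : ∀ s, deriv η s * ⟪ι w, ι (z (T - s))⟫ +
        η s * ⟪ContinuousLinearMap.adjoint A w, z (T - s)⟫ =
        (fun s => deriv η (T - s) * ⟪ι w, ι (z s)⟫ + η (T - s) * ⟪w, A (z s)⟫) (T - s) := by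
      intro s
      simp only [sub_sub_cancel, ContinuousLinearMap.adjoint_inner_left]
    simp only [e]
    rw [hmp.integral_comp hme
      (fun s => deriv η (T - s) * ⟪ι w, ι (z s)⟫ + η (T - s) * ⟪w, A (z s)⟫)]
    have hη' : IsTestFunction (Iio T) (fun s => η (T - s)) := by
      refine ⟨hη.1.comp (contDiff_const.sub contDiff_id),
        hη.2.1.comp_homeomorph (Homeomorph.subLeft T), fun s hs => ?_⟩
      have hs' : s ∈ tsupport (η ∘ (Homeomorph.subLeft T)) := hs
      rw [tsupport_comp_eq_preimage η (Homeomorph.subLeft T)] at hs'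
      have := hη.2.2 hs'
      simpa using this
    have hd : ∀ s, deriv (fun s => η (T - s)) s = -deriv η (T - s) := fun s => by
      rw [deriv_comp_const_sub]
    have h1 := hweak w _ hη'
    simp only [hd] at h1
    obtain ⟨C, hC⟩ := hη'.2.1.exists_bound_of_continuous hη'.1.continuous
    obtain ⟨C', hC'⟩ := hη.deriv_bound
    have i1 : Integrable (fun s => ⟪ι w, ι (z s)⟫) (timeMeasure T) :=
      ((innerSL ℝ (ι w)) ∘L ι).integrable_comp hz
    have i2 : Integrable (fun s => ⟪w, A (z s)⟫) (timeMeasure T) :=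
      ((innerSL ℝ w) ∘L A).integrable_comp hz
    have c1 := hη'.1.continuous
    have c2 := hη.1.continuous_deriv (by simp)
    rw [integral_add]
    · have e1 : ∫ s in Ioo 0 T, deriv η (T - s) * ⟪ι w, ι (z s)⟫ =
          -∫ s in Ioo 0 T, ⟪ι (z s), ι w⟫ * -deriv η (T - s) := by
        rw [← integral_neg]
        refine integral_congr_ae (ae_of_all _ fun s => ?_)
        simp only [real_inner_comm (ι w)]
        ring
      have e2 : ∫ s in Ioo 0 T, η (T - s) * ⟪w, A (z s)⟫ =
          ∫ s in Ioo 0 T, ⟪A (z s), w⟫ * η (T - s) := by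
        refine integral_congr_ae (ae_of_all _ fun s => ?_)
        simp only [real_inner_comm w]
        ring
      rw [e1, e2, h1]
      ring
    · exact i1.bdd_mul (c := C') (c2.comp (by fun_prop)).aestronglyMeasurable
        (ae_of_all _ fun s => hC' _)
    · exact i2.bdd_mul (c := C) c1.aestronglyMeasurable (ae_of_all _ fun s => hC s)
  have := hmp.quasiMeasurePreserving.ae hcore
  filter_upwards [this] with s hs
  simpa using hs

end Parabolic

/-- The unit `1 - (-x)^m` factors as `1 + x` times a finite geometric sum, and the two factors
commute, so each of them is a unit. -/
lemma isUnit_one_add_of_norm_pow_lt_one {R : Type*} [NormedRing R] [HasSummableGeomSeries R]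
    {x : R} {m : ℕ} (hx : ‖x ^ m‖ < 1) : IsUnit (1 + x) := by
  have h0 : ‖(-x) ^ m‖ < 1 := by
    rw [neg_pow]
    rcases neg_one_pow_eq_or R m with h | h <;> simpa [h] using hx
  have h1 : IsUnit (1 - (-x) ^ m) := isUnit_one_sub_of_norm_lt_one h0
  have h2 : (1 - (-x)) * ∑ i ∈ Finset.range m, (-x) ^ i = 1 - (-x) ^ m := mul_neg_geom_sum _ _
  have h3 : (∑ i ∈ Finset.range m, (-x) ^ i) * (1 - (-x)) = 1 - (-x) ^ m := geom_sum_mul_neg _ _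
  rw [← h2] at h1
  have := ((show Commute (1 - (-x)) (∑ i ∈ Finset.range m, (-x) ^ i) from h2.trans h3.symm
    ).isUnit_mul_iff.1 h1).1
  rwa [sub_neg_eq_add] at this

/-! ### The controlled equation as a Volterra equation. -/

section Parabolic

variable {V H U : Type*} [NormedAddCommGroup V] [InnerProductSpace ℝ V]
  [NormedAddCommGroup H] [InnerProductSpace ℝ H] [NormedAddCommGroup U] [NormedSpace ℝ U]
  {T : ℝ} {ι : V →L[ℝ] H} {A : V →L[ℝ] V} {B : U →L[ℝ] H →L[ℝ] V} {α lam : ℝ}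

/-- The pair of an initial value and a right hand side. -/
def mkData (T : ℝ) : H × Lp V 2 (timeMeasure T) →L[ℝ] DataSpace V H T :=
  (WithLp.prodContinuousLinearEquiv 2 ℝ H (Lp V 2 (timeMeasure T))).symm

/-- The right hand side `B(u) y` belonging to a control `u` and a state `y`. -/
def controlTerm (T : ℝ) (B : U →L[ℝ] H →L[ℝ] V) :
    Lp U 2 (timeMeasure T) →L[ℝ] BoundedContinuousFunction ℝ H →L[ℝ] Lp V 2 (timeMeasure T) :=
  (ContinuousLinearMap.compL ℝ (BoundedContinuousFunction ℝ H) (Lp H ∞ (timeMeasure T))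
    (Lp V 2 (timeMeasure T))).flip (BoundedContinuousFunction.toLp ∞ (timeMeasure T) ℝ) ∘L
    B.holderL (timeMeasure T) 2 ∞ 2

lemma coeFn_controlTerm (u : Lp U 2 (timeMeasure T)) (y : BoundedContinuousFunction ℝ H) :
    controlTerm T B u y =ᵐ[timeMeasure T] fun t => B (u t) (y t) := by
  have h1 : controlTerm T B u y =
    B.holder 2 u (BoundedContinuousFunction.toLp ∞ (timeMeasure T) ℝ y) := rfl
  rw [h1]
  filter_upwards [B.coeFn_holder (r := 2) u
    (BoundedContinuousFunction.toLp ∞ (timeMeasure T) ℝ y),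
    BoundedContinuousFunction.coeFn_toLp ∞ (timeMeasure T) ℝ y] with t h1 h2
  rw [h1, h2]

variable [CompleteSpace V] [CompleteSpace H]

/-- The continuous solution belonging to an initial value and a right hand side. -/
def solC (hT : 0 ≤ T) (ι : V →L[ℝ] H) (A : V →L[ℝ] V) :
    H × Lp V 2 (timeMeasure T) →L[ℝ] BoundedContinuousFunction ℝ H :=
  ContinuousLinearMap.fst ℝ _ _ ∘L solOp hT ι A ∘L mkData T

/-- The solution in `L²(0,T; V)` belonging to an initial value and a right hand side. -/
def solV (hT : 0 ≤ T) (ι : V →L[ℝ] H) (A : V →L[ℝ] V) :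
    H × Lp V 2 (timeMeasure T) →L[ℝ] Lp V 2 (timeMeasure T) :=
  ContinuousLinearMap.snd ℝ _ _ ∘L solOp hT ι A ∘L mkData T

/-- The Volterra operator `y ↦ z`, where `z' + A z = B(u) y` and `z(0) = 0`. -/
def volterra (hT : 0 ≤ T) (ι : V →L[ℝ] H) (A : V →L[ℝ] V) (B : U →L[ℝ] H →L[ℝ] V) :
    Lp U 2 (timeMeasure T) →L[ℝ]
      BoundedContinuousFunction ℝ H →L[ℝ] BoundedContinuousFunction ℝ H :=
  (ContinuousLinearMap.compL ℝ (BoundedContinuousFunction ℝ H) (Lp V 2 (timeMeasure T))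
    (BoundedContinuousFunction ℝ H)
    (solC hT ι A ∘L ContinuousLinearMap.inr ℝ H (Lp V 2 (timeMeasure T)))) ∘L controlTerm T B

lemma volterra_apply (hT : 0 ≤ T) (u : Lp U 2 (timeMeasure T))
    (y : BoundedContinuousFunction ℝ H) :
    volterra hT ι A B u y = solC hT ι A (0, controlTerm T B u y) := rfl

/-- A Gronwall type inequality. Here the pointwise bound on `u` is essential, whereas the mere
continuity of `K(u)` needs only `u` in L². -/
lemma volterra_estimate (hT : 0 < T) (hι : DenseRange ι) (hA : Garding ι A α lam)
    {u : Lp U 2 (timeMeasure T)} {M : ℝ} (hu : ∀ᵐ t ∂(timeMeasure T), ‖u t‖ ≤ M)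
    (y : BoundedContinuousFunction ℝ H) (t : ℝ) :
    ‖volterra hT.le ι A B u y t‖ ^ 2 ≤
      energyConst α lam T * (‖B‖ * M) ^ 2 * ∫ s in Iio t, ‖y s‖ ^ 2 ∂(timeMeasure T) := by
  refine (solOp_estimate hT hι hA (mkData T (0, controlTerm T B u y)) t).trans ?_
  rw [mul_assoc]
  refine mul_le_mul_of_nonneg_left ?_ (energyConst_nonneg hA.1 _ _)
  have h1 : (mkData T ((0 : H), controlTerm T B u y)).fst = 0 := rfl
  have h2 : (mkData T ((0 : H), controlTerm T B u y)).snd = controlTerm T B u y := rfl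
  rw [h1, h2, norm_zero, zero_pow two_ne_zero, zero_add, ← integral_const_mul]
  refine integral_mono_ae (integrable_norm_sq _).integrableOn ?_ ?_
  · refine (Integrable.of_bound (C := ‖y‖ ^ 2) ?_ (ae_of_all _ fun s => ?_)).const_mul _
    · exact (y.continuous.norm.pow 2).aestronglyMeasurable
    · rw [norm_pow, norm_norm]
      gcongr
      exact y.norm_coe_le_norm s
  · refine ae_restrict_of_ae ?_
    filter_upwards [coeFn_controlTerm (B := B) u y, hu] with s hs hs'
    rw [hs, ← mul_pow]
    gcongr
    refine (B.le_opNorm₂ _ _).trans ?_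
    gcongr

/-- Each application of `volterra_estimate` integrates a power of time once more, which builds up
the factorial. -/
lemma volterra_pow_estimate (hT : 0 < T) (hι : DenseRange ι) (hA : Garding ι A α lam)
    {u : Lp U 2 (timeMeasure T)} {M : ℝ} (hu : ∀ᵐ t ∂(timeMeasure T), ‖u t‖ ≤ M)
    (y : BoundedContinuousFunction ℝ H) (m : ℕ) (t : ℝ) :
    ‖((volterra hT.le ι A B u) ^ m) y t‖ ^ 2 ≤
      (energyConst α lam T * (‖B‖ * M) ^ 2) ^ m * (projIcc 0 T hT.le t : ℝ) ^ m / m.factorial *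
        ‖y‖ ^ 2 := by
  set L := energyConst α lam T * (‖B‖ * M) ^ 2 with hL
  have hL0 : 0 ≤ L := mul_nonneg (energyConst_nonneg hA.1 _ _) (sq_nonneg _)
  induction m generalizing t with
  | zero =>
    simp only [pow_zero, Nat.factorial_zero, Nat.cast_one, mul_one, div_one, one_mul]
    gcongr
    exact y.norm_coe_le_norm t
  | succ m ih =>
    have hsucc : ((volterra hT.le ι A B u) ^ (m + 1)) y =
        volterra hT.le ι A B u (((volterra hT.le ι A B u) ^ m) y) :=
      DFunLike.congr_fun (pow_succ' (volterra hT.le ι A B u) m) y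
    rw [hsucc]
    refine (volterra_estimate hT hι hA hu _ t).trans ?_
    obtain ⟨τ, hτ⟩ : ∃ τ : ℝ, τ = (projIcc 0 T hT.le t).1 := ⟨_, rfl⟩
    have hτm : τ ∈ Icc 0 T := hτ ▸ (projIcc 0 T hT.le t).2
    have h4 : τ = max 0 (min T t) := hτ
    rw [← hτ]
    have hsub : Iio t ∩ Ioo 0 T ⊆ Ioo 0 τ := fun s hs =>
      ⟨hs.2.1, by rw [h4]; exact lt_max_of_lt_right (lt_min hs.2.2 hs.1)⟩
    have h5 : ∫ s in Iio t, ‖((volterra hT.le ι A B u) ^ m) y s‖ ^ 2 ∂(timeMeasure T) ≤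
        ∫ s in Ioo 0 τ, L ^ m * s ^ m / m.factorial * ‖y‖ ^ 2 := by
      rw [Measure.restrict_restrict measurableSet_Iio]
      have hi : IntegrableOn (fun s : ℝ => L ^ m * s ^ m / m.factorial * ‖y‖ ^ 2) (Ioo 0 τ) :=
        ((by fun_prop : Continuous fun s : ℝ => L ^ m * s ^ m / m.factorial * ‖y‖ ^ 2
          ).continuousOn.integrableOn_Icc (a := 0) (b := τ)).mono_set Ioo_subset_Icc_self
      refine (integral_mono_ae (g := fun s => L ^ m * s ^ m / m.factorial * ‖y‖ ^ 2) ?_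
        (hi.mono_set hsub) ?_).trans (setIntegral_mono_set hi ?_ (LE.le.eventuallyLE hsub))
      · refine Measure.integrableOn_of_bounded (M := ‖((volterra hT.le ι A B u) ^ m) y‖ ^ 2)
          (ne_top_of_le_ne_top (measure_Ioo_lt_top (a := 0) (b := τ)).ne (measure_mono hsub)) ?_
          (ae_of_all _ fun s => ?_)
        · exact (BoundedContinuousFunction.continuous _ |>.norm.pow 2).aestronglyMeasurable
        · rw [norm_pow, norm_norm]
          gcongr
          exact BoundedContinuousFunction.norm_coe_le_norm _ s
      · refine (ae_restrict_iff' (measurableSet_Iio.inter measurableSet_Ioo)).2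
          (ae_of_all _ fun s hs => ?_)
        have := ih s
        rwa [projIcc_of_mem hT.le (Ioo_subset_Icc_self hs.2)] at this
      · refine (ae_restrict_iff' measurableSet_Ioo).2 (ae_of_all _ fun s hs => ?_)
        have := hs.1
        simp only [Pi.zero_apply]
        positivity
    refine (mul_le_mul_of_nonneg_left h5 hL0).trans (le_of_eq ?_)
    rw [← integral_Ioc_eq_integral_Ioo, ← intervalIntegral.integral_of_le hτm.1]
    simp only [mul_assoc, intervalIntegral.integral_const_mul,
      intervalIntegral.integral_mul_const, div_eq_mul_inv, integral_pow]
    rw [Nat.factorial_succ]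
    push_cast
    have : (m.factorial : ℝ) ≠ 0 := by exact_mod_cast m.factorial_ne_zero
    field_simp
    ring

/-- The operator `1 + K(u)`, where `K(u)` is the Volterra operator belonging to `u`, is
invertible. -/
def IsRegular (hT : 0 ≤ T) (ι : V →L[ℝ] H) (A : V →L[ℝ] V) (B : U →L[ℝ] H →L[ℝ] V)
    (u : Lp U 2 (timeMeasure T)) : Prop :=
  IsUnit (1 + volterra hT ι A B u)

lemma isRegular_of_bounded (hT : 0 < T) (hι : DenseRange ι) (hA : Garding ι A α lam)
    {u : Lp U 2 (timeMeasure T)} {M : ℝ} (hu : ∀ᵐ t ∂(timeMeasure T), ‖u t‖ ≤ M) :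
    IsRegular hT.le ι A B u := by
  unfold IsRegular
  set K := volterra hT.le ι A B u with hK
  set L := energyConst α lam T * (‖B‖ * M) ^ 2 with hL
  have hL0 : 0 ≤ L := mul_nonneg (energyConst_nonneg hA.1 _ _) (sq_nonneg _)
  have hlim := FloorSemiring.tendsto_pow_div_factorial_atTop (L * T)
  -- The estimate concerns squared norms, so `1/4` here yields `‖K ^ m‖ ≤ 1/2`.
  obtain ⟨m, hm⟩ := (hlim.eventually (gt_mem_nhds (show (0 : ℝ) < 1 / 4 by norm_num))).exists
  have hnorm : ‖K ^ m‖ < 1 := by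
    refine lt_of_le_of_lt (b := 1 / 2) ?_ (by norm_num)
    refine ContinuousLinearMap.opNorm_le_bound _ (by norm_num) fun y => ?_
    refine (BoundedContinuousFunction.norm_le (by positivity)).2 fun t => ?_
    refine (pow_le_pow_iff_left₀ (norm_nonneg _) (by positivity) two_ne_zero).1 ?_
    refine (volterra_pow_estimate hT hι hA hu y m t).trans ?_
    rw [mul_pow (1 / 2 : ℝ), ← mul_pow L]
    refine mul_le_mul_of_nonneg_right (le_trans ?_ (hm.le.trans (by norm_num))) (sq_nonneg _)
    have := (projIcc 0 T hT.le t).2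
    gcongr
    · exact mul_nonneg hL0 this.1
    · exact this.2
  exact isUnit_one_add_of_norm_pow_lt_one
    (R := BoundedContinuousFunction ℝ H →L[ℝ] BoundedContinuousFunction ℝ H) hnorm

/-- The continuous state belonging to the control `u`. -/
def stateC (hT : 0 ≤ T) (ι : V →L[ℝ] H) (A : V →L[ℝ] V) (B : U →L[ℝ] H →L[ℝ] V) (y₀ : H)
    (u : Lp U 2 (timeMeasure T)) : BoundedContinuousFunction ℝ H :=
  -- `Ring.inverse` is `0` at operators that are not invertible. This makes the state a total
  -- function on L², with its intended meaning at the regular controls, which form an open set.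
  Ring.inverse (1 + volterra hT ι A B u) (solC hT ι A (y₀, 0))

/-- The state in `L²(0,T; V)` belonging to the control `u`. -/
def stateV (hT : 0 ≤ T) (ι : V →L[ℝ] H) (A : V →L[ℝ] V) (B : U →L[ℝ] H →L[ℝ] V) (y₀ : H)
    (u : Lp U 2 (timeMeasure T)) : Lp V 2 (timeMeasure T) :=
  solV hT ι A (y₀, -controlTerm T B u (stateC hT ι A B y₀ u))

lemma stateC_fixed (hT : 0 ≤ T) {u : Lp U 2 (timeMeasure T)}
    (hu : IsRegular hT ι A B u) (y₀ : H) :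
    stateC hT ι A B y₀ u = solC hT ι A (y₀, -controlTerm T B u (stateC hT ι A B y₀ u)) := by
  have h1 : (1 + volterra hT ι A B u) (stateC hT ι A B y₀ u) = solC hT ι A (y₀, 0) := by
    have := Ring.mul_inverse_cancel _ hu
    unfold stateC
    rw [← mul_apply_eq_comp, this, one_apply_eq_self]
  have h2 : ((y₀, -controlTerm T B u (stateC hT ι A B y₀ u)) : H × Lp V 2 (timeMeasure T)) =
      (y₀, 0) - (0, controlTerm T B u (stateC hT ι A B y₀ u)) := by simp
  rw [h2, map_sub, ← h1, ← volterra_apply]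
  simp

lemma eq_stateC_of_fixed (hT : 0 ≤ T) {u : Lp U 2 (timeMeasure T)}
    (hu : IsRegular hT ι A B u) {y₀ : H} {y : BoundedContinuousFunction ℝ H}
    (hy : y = solC hT ι A (y₀, -controlTerm T B u y)) : y = stateC hT ι A B y₀ u := by
  have h2 : ((y₀, -controlTerm T B u y) : H × Lp V 2 (timeMeasure T)) =
      (y₀, 0) - (0, controlTerm T B u y) := by simp
  rw [h2, map_sub, ← volterra_apply] at hy
  have h1 : (1 + volterra hT ι A B u) y = solC hT ι A (y₀, 0) := by
    rw [add_apply, one_apply_eq_self]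
    nth_rewrite 1 [hy]
    abel
  unfold stateC
  rw [← h1, ← mul_apply_eq_comp, Ring.inverse_mul_cancel _ hu,
    one_apply_eq_self]

lemma stateC_ae (hT : 0 < T) (hι : DenseRange ι) (hA : Garding ι A α lam)
    {u : Lp U 2 (timeMeasure T)} (hu : IsRegular hT.le ι A B u) (y₀ : H) :
    ∀ᵐ t ∂(timeMeasure T), stateC hT.le ι A B y₀ u t = ι (stateV hT.le ι A B y₀ u t) := by
  have h1 := solOp_coe_ae hT hι hA
    (mkData T (y₀, -controlTerm T B u (stateC hT.le ι A B y₀ u)))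
  filter_upwards [h1] with t ht
  rw [stateC_fixed hT.le hu y₀]
  exact ht

lemma stateC_zero (hT : 0 < T) (hι : DenseRange ι) (hA : Garding ι A α lam)
    {u : Lp U 2 (timeMeasure T)} (hu : IsRegular hT.le ι A B u) (y₀ : H) :
    stateC hT.le ι A B y₀ u 0 = y₀ := by
  rw [stateC_fixed hT.le hu y₀]
  exact solOp_zero hT hι hA _

lemma stateV_weak (hT : 0 < T) (hι : DenseRange ι) (hA : Garding ι A α lam)
    {u : Lp U 2 (timeMeasure T)} (hu : IsRegular hT.le ι A B u) (y₀ : H)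
    (φ : V) {η : ℝ → ℝ} (hη : IsTestFunction (Ioo 0 T) η) :
    ∫ t in Ioo 0 T, ⟪ι (stateV hT.le ι A B y₀ u t), ι φ⟫ * deriv η t =
      ∫ t in Ioo 0 T, ⟪A (stateV hT.le ι A B y₀ u t) +
        B (u t) (ι (stateV hT.le ι A B y₀ u t)), φ⟫ * η t := by
  refine (solOp_weak hT hι hA (mkData T (y₀, -controlTerm T B u (stateC hT.le ι A B y₀ u)))
    φ hη).trans ?_
  rw [← integral_neg]
  refine integral_congr_ae ?_
  have h2 : (mkData T (y₀, -controlTerm T B u (stateC hT.le ι A B y₀ u))).snd =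
    -controlTerm T B u (stateC hT.le ι A B y₀ u) := rfl
  filter_upwards [stateC_ae hT hι hA hu y₀,
    coeFn_controlTerm (B := B) u (stateC hT.le ι A B y₀ u),
    Lp.coeFn_neg (controlTerm T B u (stateC hT.le ι A B y₀ u))] with t h3 h4 h5
  rw [h2, h5, Pi.neg_apply, h4, h3]
  change -(⟪-_ - A (stateV hT.le ι A B y₀ u t), φ⟫ * η t) = _
  rw [inner_sub_left, inner_neg_left, inner_add_left]
  ring

/-- Uniqueness of weak solutions of the controlled equation. -/
lemma eq_stateV_of_weak (hT : 0 < T) (hι : DenseRange ι) (hA : Garding ι A α lam)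
    {u : Lp U 2 (timeMeasure T)} (hu : IsRegular hT.le ι A B u) {y₀ : H}
    {z : Lp V 2 (timeMeasure T)} {y : ℝ → H} (hy : ContinuousOn y (Icc 0 T))
    (hyz : ∀ᵐ t ∂(timeMeasure T), y t = ι (z t)) (hy0 : y 0 = y₀)
    (h : ∀ φ : V, ∀ η : ℝ → ℝ, IsTestFunction (Ioo 0 T) η →
      ∫ t in Ioo 0 T, ⟪ι (z t), ι φ⟫ * deriv η t =
        ∫ t in Ioo 0 T, ⟪A (z t) + B (u t) (ι (z t)), φ⟫ * η t) :
    z = stateV hT.le ι A B y₀ u := by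
  have hYc : Continuous fun t => y (projIcc 0 T hT.le t) :=
    hy.domRestrict.comp continuous_projIcc
  set Y : BoundedContinuousFunction ℝ H := extendBCF hT.le ⟨_, hYc⟩ with hY
  have hYy : ∀ t ∈ Icc 0 T, Y t = y t := fun t ht => by
    rw [hY, extendBCF_of_mem hT.le _ ht]
    simp [projIcc_of_mem hT.le ht]
  -- The weak solution is compared with the solution of the linear equation whose source `-B(u) Y`
  -- is computed from the weak solution itself. The control term cancels, and the difference solves
  -- the homogeneous equation for `A` with initial value `0`.
  set d := mkData T (y₀, -controlTerm T B u Y) with hd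
  have hdiff : (fun t => z t - (solOp hT.le ι A d).2 t) =ᵐ[timeMeasure T] 0 := by
    have iz := (Lp.memLp z).integrable one_le_two
    have iw := (Lp.memLp (solOp hT.le ι A d).2).integrable one_le_two
    refine ae_eq_zero_of_weak hT hA (iz.sub iw)
      (y := fun t => y t - (solOp hT.le ι A d).1 t)
      (hy.sub (solOp hT.le ι A d).1.continuous.continuousOn) ?_ ?_ ?_
    · filter_upwards [hyz, solOp_coe_ae hT hι hA d] with t h1 h2
      simp only [h1, h2, map_sub]
    · rw [hy0, solOp_zero hT hι hA]
      exact sub_self _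
    · intro φ η hη
      have h1 := h φ η hη
      have h2 := solOp_weak hT hι hA d φ hη
      obtain ⟨C, hC⟩ := hη.2.1.exists_bound_of_continuous hη.1.continuous
      obtain ⟨C', hC'⟩ := hη.deriv_bound
      have c1 := hη.1.continuous
      have c2 := hη.1.continuous_deriv (by simp)
      have m1 : ∀ f : ℝ → V, Integrable f (timeMeasure T) →
          Integrable (fun t => ⟪ι (f t), ι φ⟫ * deriv η t) (timeMeasure T) := by
        intro f hf
        have : Integrable (fun t => ⟪ι φ, ι (f t)⟫) (timeMeasure T) :=
          ((innerSL ℝ (ι φ)) ∘L ι).integrable_comp hf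
        replace this := this.congr (ae_of_all _ fun t => real_inner_comm (ι (f t)) (ι φ))
        exact this.mul_bdd (c := C') c2.aestronglyMeasurable (ae_of_all _ fun s => hC' s)
      have m2 : ∀ f : ℝ → V, Integrable f (timeMeasure T) →
          Integrable (fun t => ⟪f t, φ⟫ * η t) (timeMeasure T) := by
        intro f hf
        have : Integrable (fun t => ⟪φ, f t⟫) (timeMeasure T) :=
          (innerSL ℝ φ).integrable_comp hf
        replace this := this.congr (ae_of_all _ fun t => real_inner_comm (f t) φ)
        exact this.mul_bdd (c := C) c1.aestronglyMeasurable (ae_of_all _ fun s => hC s)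
      have e1 : ∫ t in Ioo 0 T, ⟪ι (z t - (solOp hT.le ι A d).2 t), ι φ⟫ * deriv η t =
          (∫ t in Ioo 0 T, ⟪ι (z t), ι φ⟫ * deriv η t) -
            ∫ t in Ioo 0 T, ⟪ι ((solOp hT.le ι A d).2 t), ι φ⟫ * deriv η t := by
        rw [← integral_sub (m1 _ iz) (m1 _ iw)]
        refine integral_congr_ae (ae_of_all _ fun t => ?_)
        simp only [map_sub, inner_sub_left, sub_mul]
      have hctl : ∀ᵐ t ∂(timeMeasure T), d.snd t = -B (u t) (ι (z t)) := by
        have h3 : d.snd = -controlTerm T B u Y := rfl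
        filter_upwards [coeFn_controlTerm (B := B) u Y, Lp.coeFn_neg (controlTerm T B u Y), hyz,
          ae_restrict_mem measurableSet_Ioo] with t h4 h5 h6 h7
        rw [h3, h5, Pi.neg_apply, h4, hYy t (Ioo_subset_Icc_self h7), h6]
      have iA : Integrable (fun t => A (z t) + B (u t) (ι (z t))) (timeMeasure T) := by
        refine (A.integrable_comp iz).add ?_
        have := ((Lp.memLp d.snd).integrable one_le_two).neg
        refine this.congr ?_
        filter_upwards [hctl] with t ht
        simp [ht]
      have iB : Integrable (fun t => d.snd t - A ((solOp hT.le ι A d).2 t)) (timeMeasure T) :=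
        ((Lp.memLp d.snd).integrable one_le_two).sub (A.integrable_comp iw)
      rw [e1, h1, h2, sub_neg_eq_add, ← integral_add (m2 _ iA) (m2 _ iB)]
      refine integral_congr_ae ?_
      filter_upwards [hctl] with t ht
      rw [ht, ← add_mul, ← inner_add_left, map_sub]
      congr 2
      abel
  have hz : z = (solOp hT.le ι A d).2 := by
    refine Lp.ext ?_
    filter_upwards [hdiff] with t ht
    exact sub_eq_zero.1 ht
  have hctl : controlTerm T B u Y = controlTerm T B u (solOp hT.le ι A d).1 := by
    refine Lp.ext ?_
    filter_upwards [coeFn_controlTerm (B := B) u Y,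
      coeFn_controlTerm (B := B) u (solOp hT.le ι A d).1, hyz, solOp_coe_ae hT hι hA d,
      ae_restrict_mem measurableSet_Ioo] with t h1 h2 h3 h4 h5
    rw [h1, h2, hYy t (Ioo_subset_Icc_self h5), h3, h4, ← hz]
  -- The two solutions coincide, so the source may be computed from the linear solution. This is the
  -- fixed point equation, whose only solution is the state.
  have hfix : (solOp hT.le ι A d).1 =
      solC hT.le ι A (y₀, -controlTerm T B u (solOp hT.le ι A d).1) := by
    rw [← hctl]; rfl
  have hst := eq_stateC_of_fixed hT.le hu hfix
  rw [hz]
  unfold stateV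
  rw [← hst, ← hctl]
  rfl

/-- The state depends smoothly on the control. -/
lemma contDiffAt_stateC (hT : 0 ≤ T) {u : Lp U 2 (timeMeasure T)}
    (hu : IsRegular hT ι A B u) (y₀ : H) {k : WithTop ℕ∞} :
    ContDiffAt ℝ k (stateC hT ι A B y₀) u := by
  obtain ⟨x, hx⟩ := hu
  -- Inversion is smooth near a unit, and `u ↦ 1 + K(u)` is affine and continuous in the L² norm.
  have h1 : ContDiffAt ℝ k Ring.inverse (1 + volterra hT ι A B u) := by
    rw [← hx]
    exact contDiffAt_ringInverse ℝ
      (R := BoundedContinuousFunction ℝ H →L[ℝ] BoundedContinuousFunction ℝ H) x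
  have h2 : ContDiffAt ℝ k (fun u => 1 + volterra hT ι A B u) u :=
    contDiffAt_const.add (ContinuousLinearMap.contDiff _).contDiffAt
  exact (h1.comp u h2).clm_apply contDiffAt_const

end Parabolic

/-! ### The space `H¹(Ω)` and the operators of the state equation -/

section Sobolev

variable {n : ℕ} {Ω : Set (E n)}

lemma IsTestFunction.memLp_smul {φ : E n → ℝ} (h : IsTestFunction Ω φ) (e : E n) :
    MemLp (fun x => φ x • e) 2 (volume.restrict Ω) := by
  have hc : Continuous fun x => φ x • e := h.1.continuous.smul continuous_const
  exact (hc.memLp_of_hasCompactSupport (h.2.1.smul_right (f' := fun _ => e))).restrict _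

lemma integral_mul_eq_inner {f : L2 Ω} {k : E n → ℝ} (hk : MemLp k 2 (volume.restrict Ω)) :
    ∫ x in Ω, f x * k x = ⟪f, hk.toLp k⟫ := by
  rw [L2.inner_def]
  refine integral_congr_ae ?_
  filter_upwards [hk.coeFn_toLp] with x hx
  rw [hx]
  simp [mul_comm]

lemma integral_inner_mul_eq_inner {g : Lp (E n) 2 (volume.restrict Ω)} {φ : E n → ℝ}
    (h : IsTestFunction Ω φ) (e : E n) :
    ∫ x in Ω, ⟪g x, e⟫ * φ x = ⟪g, (h.memLp_smul e).toLp _⟫ := by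
  rw [L2.inner_def]
  refine integral_congr_ae ?_
  filter_upwards [(h.memLp_smul e).coeFn_toLp] with x hx
  rw [hx, real_inner_smul_right, mul_comm]

lemma continuous_fst_L2Pair : Continuous fun f : L2Pair Ω => f.fst :=
  (WithLp.prod_continuous_ofLp 2 _ _).fst

lemma continuous_snd_L2Pair : Continuous fun f : L2Pair Ω => f.snd :=
  (WithLp.prod_continuous_ofLp 2 _ _).snd

/-- For a fixed test function and direction, the identity defining the weak gradient equates two
continuous linear functionals of the pair. Completeness of H¹(Ω) follows. -/
lemma isClosed_H1 : IsClosed (H1 Ω : Set (L2Pair Ω)) := by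
  have h : (H1 Ω : Set (L2Pair Ω)) = ⋂ (φ : E n → ℝ) (hφ : IsTestFunction Ω φ) (e : E n),
      {f | ⟪f.fst, (hφ.memLp_fderiv e).toLp _⟫ = -⟪f.snd, (hφ.memLp_smul e).toLp _⟫} := by
    ext f
    simp only [mem_iInter, mem_ofPred_eq]
    refine forall_congr' fun φ => forall_congr' fun hφ => forall_congr' fun e => ?_
    rw [integral_mul_eq_inner (hφ.memLp_fderiv e), integral_inner_mul_eq_inner hφ e]
  rw [h]
  refine isClosed_iInter fun φ => isClosed_iInter fun hφ => isClosed_iInter fun e => ?_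
  exact isClosed_eq (continuous_fst_L2Pair.inner continuous_const)
    (continuous_snd_L2Pair.inner continuous_const).neg

instance completeSpace_H1 : CompleteSpace (H1 Ω) :=
  isClosed_H1.completeSpace_coe

/-- The embedding of `H¹(Ω)` in `L²(Ω)`. -/
def H1toL2 (Ω : Set (E n)) : H1 Ω →L[ℝ] L2 Ω :=
  ContinuousLinearMap.fst ℝ _ _ ∘L (WithLp.prodContinuousLinearEquiv 2 ℝ (L2 Ω)
    (Lp (E n) 2 (volume.restrict Ω))).toContinuousLinearMap ∘L (H1 Ω).subtypeL

/-- The weak gradient as a continuous linear map. -/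
def H1gradL (Ω : Set (E n)) : H1 Ω →L[ℝ] Lp (E n) 2 (volume.restrict Ω) :=
  ContinuousLinearMap.snd ℝ _ _ ∘L (WithLp.prodContinuousLinearEquiv 2 ℝ (L2 Ω)
    (Lp (E n) 2 (volume.restrict Ω))).toContinuousLinearMap ∘L (H1 Ω).subtypeL

lemma norm_sq_H1 (f : H1 Ω) : ‖f‖ ^ 2 = ‖H1toL2 Ω f‖ ^ 2 + ‖H1gradL Ω f‖ ^ 2 := by
  have := WithLp.prod_norm_sq_eq_of_L2 (f : L2Pair Ω)
  exact this

lemma inner_gradient (φ : E n → ℝ) (x e : E n) : ⟪gradient φ x, e⟫ = fderiv ℝ φ x e := by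
  rw [← toDual_gradient, InnerProductSpace.toDual_apply_apply]

lemma IsTestFunction.memLp_gradient {φ : E n → ℝ} (h : IsTestFunction Ω φ) :
    MemLp (gradient φ) 2 (volume.restrict Ω) := by
  have hc : Continuous (gradient φ) :=
    (InnerProductSpace.toDual ℝ (E n)).symm.continuous.comp (h.1.continuous_fderiv (by simp))
  have hs : HasCompactSupport (gradient φ) :=
    (h.2.1.fderiv ℝ).comp_left (g := (InnerProductSpace.toDual ℝ (E n)).symm) (map_zero _)
  exact (hc.memLp_of_hasCompactSupport hs).restrict _

/-- Test functions belong to `H¹(Ω)`. -/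
def IsTestFunction.toH1 {φ : E n → ℝ} (h : IsTestFunction Ω φ) : H1 Ω :=
  ⟨WithLp.toLp 2 (h.memLp.toLp φ, h.memLp_gradient.toLp _), by
    intro ψ hψ e
    have h1 : ∫ x in Ω, (h.memLp.toLp φ) x * fderiv ℝ ψ x e = ∫ x, φ x * fderiv ℝ ψ x e := by
      refine Eq.trans (integral_congr_ae ?_)
        (setIntegral_eq_integral_of_forall_compl_eq_zero fun x hx => ?_)
      · filter_upwards [h.memLp.coeFn_toLp] with x hx
        rw [hx]
      · rw [h.eq_zero hx, zero_mul]
    have h2 : ∫ x in Ω, ⟪(h.memLp_gradient.toLp _) x, e⟫ * ψ x = ∫ x, fderiv ℝ φ x e * ψ x := by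
      refine Eq.trans (integral_congr_ae ?_)
        (setIntegral_eq_integral_of_forall_compl_eq_zero fun x hx => ?_)
      · filter_upwards [h.memLp_gradient.coeFn_toLp] with x hx
        rw [hx, inner_gradient]
      · rw [hψ.eq_zero hx, mul_zero]
    have c1 := h.1.continuous
    have c2 := hψ.1.continuous
    have c3 : Continuous fun x => fderiv ℝ φ x e :=
      (h.1.continuous_fderiv (by simp)).clm_apply continuous_const
    have c4 : Continuous fun x => fderiv ℝ ψ x e :=
      (hψ.1.continuous_fderiv (by simp)).clm_apply continuous_const
    change ∫ x in Ω, (h.memLp.toLp φ) x * fderiv ℝ ψ x e =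
      -∫ x in Ω, ⟪(h.memLp_gradient.toLp _) x, e⟫ * ψ x
    rw [h1, h2]
    refine integral_mul_fderiv_eq_neg_fderiv_mul_of_integrable ?_ ?_ ?_
      (fun x _ => h.1.differentiable (by simp) x) (fun x _ => hψ.1.differentiable (by simp) x)
    · exact (c3.mul c2).integrable_of_hasCompactSupport hψ.2.1.mul_left
    · exact (c1.mul c4).integrable_of_hasCompactSupport h.2.1.mul_right
    · exact (c1.mul c2).integrable_of_hasCompactSupport h.2.1.mul_right⟩

/-- H¹(Ω) contains the test functions, and a function in L²(Ω) orthogonal to all of them vanishes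
almost everywhere. -/
lemma denseRange_H1toL2 (hΩ : IsOpen Ω) : DenseRange (H1toL2 Ω) := by
  have : (LinearMap.range (H1toL2 Ω).toLinearMap).topologicalClosure = ⊤ := by
    rw [Submodule.topologicalClosure_eq_top_iff, Submodule.eq_bot_iff]
    intro f hf
    have h1 : ∀ φ : E n → ℝ, IsTestFunction Ω φ → ∫ x in Ω, φ x • f x = 0 := by
      intro φ hφ
      have h2 := (Submodule.mem_orthogonal _ _).1 hf _ (LinearMap.mem_range_self _ hφ.toH1)
      rw [real_inner_comm] at h2
      have h3 : ∫ x in Ω, f x * φ x = 0 := (integral_mul_eq_inner hφ.memLp).trans h2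
      rw [← h3]
      refine integral_congr_ae (ae_of_all _ fun x => ?_)
      simp [mul_comm]
    have h2 : LocallyIntegrableOn f Ω volume := by
      have := ((Lp.memLp f).locallyIntegrable one_le_two)
      exact (locallyIntegrableOn_of_locallyIntegrable_restrict this)
    have h3 := hΩ.ae_eq_zero_of_integral_contDiff_smul_eq_zero h2 (fun g hg1 hg2 hg3 => by
      rw [← h1 g ⟨hg1, hg2, hg3⟩]
      symm
      refine setIntegral_eq_integral_of_forall_compl_eq_zero fun s hs => ?_
      rw [IsTestFunction.eq_zero ⟨hg1, hg2, hg3⟩ hs, zero_smul])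
    refine Lp.ext ?_
    filter_upwards [(ae_restrict_iff' hΩ.measurableSet).2 h3,
      Lp.coeFn_zero ℝ 2 (volume.restrict Ω)] with x h4 h5
    rw [h4, h5, Pi.zero_apply]
  exact (Submodule.dense_iff_topologicalClosure_eq_top).2 this

/-- The componentwise product as a continuous bilinear map. -/
def cmulL (n : ℕ) : E n →L[ℝ] E n →L[ℝ] E n :=
  (LinearMap.mk₂ ℝ cmul
    (fun _ _ _ => by ext i; simp [cmul, add_mul]) (fun _ _ _ => by ext i; simp [cmul, mul_assoc])
    (fun _ _ _ => by ext i; simp [cmul, mul_add])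
    (fun _ _ _ => by ext i; simp [cmul, mul_left_comm])).toContinuousBilinearMap

/-- Multiplication of a function in `L²(Ω)` by a bounded vector field. -/
def fieldMul (Ω : Set (E n)) :
    Lp (E n) ∞ (volume.restrict Ω) →L[ℝ] L2 Ω →L[ℝ] Lp (E n) 2 (volume.restrict Ω) :=
  ((ContinuousLinearMap.lsmul ℝ ℝ : ℝ →L[ℝ] E n →L[ℝ] E n).holderL
    (volume.restrict Ω) 2 ∞ 2).flip

lemma coeFn_fieldMul (w : Lp (E n) ∞ (volume.restrict Ω)) (h : L2 Ω) :
    fieldMul Ω w h =ᵐ[volume.restrict Ω] fun x => h x • w x :=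
  (ContinuousLinearMap.lsmul ℝ ℝ : ℝ →L[ℝ] E n →L[ℝ] E n).coeFn_holder (r := 2) h w

/-- The vector field `b ⊗ u` as a function of `u`. -/
def cmulField (b : Lp (E n) ∞ (volume.restrict Ω)) : E n →L[ℝ] Lp (E n) ∞ (volume.restrict Ω) :=
  (ContinuousLinearMap.compLpL₂ ∞ (volume.restrict Ω) (cmulL n).flip).flip b

lemma coeFn_cmulField (b : Lp (E n) ∞ (volume.restrict Ω)) (u : E n) :
    cmulField b u =ᵐ[volume.restrict Ω] fun x => cmul (b x) u :=
  ((cmulL n).flip u).coeFn_compLpL (p := ∞) (μ := volume.restrict Ω) b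

end Sobolev

/-! ### Diffusion and drift as operators on H¹(Ω), represented through its scalar product. -/

section Operators

variable {V H W U : Type*} [NormedAddCommGroup V] [InnerProductSpace ℝ V] [CompleteSpace V]
  [NormedAddCommGroup H] [InnerProductSpace ℝ H]
  [NormedAddCommGroup W] [InnerProductSpace ℝ W] [CompleteSpace W]
  [NormedAddCommGroup U] [NormedSpace ℝ U]

/-- The operator `A` with `⟪A ψ, φ⟫ = ⟪ν D ψ + M ι ψ, D φ⟫`. -/
def diffusionOp (D : V →L[ℝ] W) (ι : V →L[ℝ] H) (ν : ℝ) (M : H →L[ℝ] W) : V →L[ℝ] V :=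
  ContinuousLinearMap.adjoint D ∘L (ν • D + M ∘L ι)

lemma inner_diffusionOp (D : V →L[ℝ] W) (ι : V →L[ℝ] H) (ν : ℝ) (M : H →L[ℝ] W) (ψ φ : V) :
    ⟪diffusionOp D ι ν M ψ, φ⟫ = ⟪ν • D ψ + M (ι ψ), D φ⟫ := by
  rw [diffusionOp, ContinuousLinearMap.comp_apply, ContinuousLinearMap.adjoint_inner_left]
  rfl

/-- The operators `B(u)` with `⟪B(u) h, φ⟫ = ⟪M(u) h, D φ⟫`. -/
def driftOp (D : V →L[ℝ] W) (M : U →L[ℝ] H →L[ℝ] W) : U →L[ℝ] H →L[ℝ] V :=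
  (ContinuousLinearMap.compL ℝ H W V (ContinuousLinearMap.adjoint D)) ∘L M

lemma inner_driftOp (D : V →L[ℝ] W) (M : U →L[ℝ] H →L[ℝ] W) (u : U) (h : H) (φ : V) :
    ⟪driftOp D M u h, φ⟫ = ⟪M u h, D φ⟫ := by
  have : driftOp D M u h = ContinuousLinearMap.adjoint D (M u h) := rfl
  rw [this, ContinuousLinearMap.adjoint_inner_left]

/-- Young's inequality, in the form of the square `h4`, absorbs the drift into half of `ν‖D v‖²`.
The summand `ν/2` of `lam` supplies the part `‖ι v‖²` of the norm of `V`; the summand `‖M‖²/(2ν)` is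
the price of the drift. -/
lemma garding_diffusionOp {D : V →L[ℝ] W} {ι : V →L[ℝ] H} {ν : ℝ} {M : H →L[ℝ] W} (hν : 0 < ν)
    (hV : ∀ v, ‖v‖ ^ 2 = ‖ι v‖ ^ 2 + ‖D v‖ ^ 2) :
    ∃ α lam, Garding ι (diffusionOp D ι ν M) α lam := by
  refine ⟨ν / 2, ν / 2 + ‖M‖ ^ 2 / (2 * ν), by positivity, by positivity, fun v => ?_⟩
  have h2 : |⟪M (ι v), D v⟫| ≤ ‖M‖ * ‖ι v‖ * ‖D v‖ := by
    refine (abs_real_inner_le_norm _ _).trans ?_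
    gcongr
    exact ContinuousLinearMap.le_opNorm _ _
  have h3 := neg_le_of_abs_le h2
  rw [inner_diffusionOp, inner_add_left, real_inner_smul_left, real_inner_self_eq_norm_sq, hV]
  have h4 : 0 ≤ (ν * ‖D v‖ - ‖M‖ * ‖ι v‖) ^ 2 / (2 * ν) := by positivity
  have h5 : (ν * ‖D v‖ - ‖M‖ * ‖ι v‖) ^ 2 / (2 * ν) =
      ν / 2 * ‖D v‖ ^ 2 - ‖M‖ * ‖ι v‖ * ‖D v‖ + ‖M‖ ^ 2 / (2 * ν) * ‖ι v‖ ^ 2 := by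
    field_simp
    ring
  linarith

end Operators

section StateOperators

variable {n : ℕ} (P : Data n)

/-- The operator `A` with `⟪A ψ, φ⟫ = ∫_Ω (ν ∇ψ + ψ c) · ∇φ`. -/
def Data.opA : H1 P.Ω →L[ℝ] H1 P.Ω :=
  diffusionOp (H1gradL P.Ω) (H1toL2 P.Ω) P.ν (fieldMul P.Ω P.c)

/-- The operators `B(u)` with `⟪B(u) h, φ⟫ = ∫_Ω h (b ⊗ u) · ∇φ`. -/
def Data.opB : E n →L[ℝ] L2 P.Ω →L[ℝ] H1 P.Ω :=
  driftOp (H1gradL P.Ω) (fieldMul P.Ω ∘L cmulField P.b)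

lemma Data.garding (hν : 0 < P.ν) : ∃ α lam, Garding (H1toL2 P.Ω) P.opA α lam :=
  garding_diffusionOp hν norm_sq_H1

lemma Data.a_eq_inner_field (u : E n) (ψ φ : H1 P.Ω) :
    P.a u ψ φ = ⟪(P.ν • H1grad ψ + fieldMul P.Ω P.c (H1val ψ)) +
        fieldMul P.Ω (cmulField P.b u) (H1val ψ), H1grad φ⟫ := by
  rw [L2.inner_def]
  unfold Data.a
  refine integral_congr_ae ?_
  filter_upwards [Lp.coeFn_add (P.ν • H1grad ψ + fieldMul P.Ω P.c (H1val ψ))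
      (fieldMul P.Ω (cmulField P.b u) (H1val ψ)),
    Lp.coeFn_add (P.ν • H1grad ψ) (fieldMul P.Ω P.c (H1val ψ)),
    Lp.coeFn_smul P.ν (H1grad ψ),
    coeFn_fieldMul P.c (H1val ψ), coeFn_fieldMul (cmulField P.b u) (H1val ψ),
    coeFn_cmulField P.b u] with x h1 h2 h3 h4 h5 h6
  rw [h1, Pi.add_apply, h2, Pi.add_apply, h3, h4, h5, h6, smul_add, add_assoc]
  rfl

/-- This identity carries the abstract results on `A + B(u) ι` over to the concrete bilinear form.
-/
lemma Data.a_eq_inner (u : E n) (ψ φ : H1 P.Ω) :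
    P.a u ψ φ = ⟪P.opA ψ + P.opB u (H1toL2 P.Ω ψ), φ⟫ := by
  have e1 : ⟪P.opA ψ, φ⟫ = ⟪P.ν • H1grad ψ + fieldMul P.Ω P.c (H1val ψ), H1grad φ⟫ :=
    inner_diffusionOp (H1gradL P.Ω) (H1toL2 P.Ω) P.ν (fieldMul P.Ω P.c) ψ φ
  have e2 : ⟪P.opB u (H1toL2 P.Ω ψ), φ⟫ =
      ⟪fieldMul P.Ω (cmulField P.b u) (H1val ψ), H1grad φ⟫ :=
    inner_driftOp (H1gradL P.Ω) (fieldMul P.Ω ∘L cmulField P.b) u (H1toL2 P.Ω ψ) φ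
  have e3 := inner_add_left (𝕜 := ℝ) (P.opA ψ) (P.opB u (H1toL2 P.Ω ψ)) φ
  have e4 := inner_add_left (𝕜 := ℝ) (P.ν • H1grad ψ + fieldMul P.Ω P.c (H1val ψ))
    (fieldMul P.Ω (cmulField P.b u) (H1val ψ)) (H1grad φ)
  rw [e3, e1, e2]
  exact (Data.a_eq_inner_field P u ψ φ).trans e4

end StateOperators

section Parabolic

variable {V H U : Type*} [NormedAddCommGroup V] [InnerProductSpace ℝ V]
  [NormedAddCommGroup H] [InnerProductSpace ℝ H] [NormedAddCommGroup U] [NormedSpace ℝ U]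
  [CompleteSpace V] [CompleteSpace H]
  {T : ℝ} {ι : V →L[ℝ] H} {A : V →L[ℝ] V} {B : U →L[ℝ] H →L[ℝ] V} {α lam : ℝ}

/-- The time derivative of the state belongs to `L²(0,T; V*)`. -/
lemma stateV_timeDeriv (hT : 0 < T) (hι : DenseRange ι) (hA : Garding ι A α lam)
    {u : Lp U 2 (timeMeasure T)} (hu : IsRegular hT.le ι A B u) (y₀ : H) :
    ∃ g : Lp (V →L[ℝ] ℝ) 2 (timeMeasure T), ∀ φ : V, ∀ η : ℝ → ℝ, IsTestFunction (Ioo 0 T) η →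
      ∫ t in Ioo 0 T, ⟪ι (stateV hT.le ι A B y₀ u t), ι φ⟫ * deriv η t =
        -∫ t in Ioo 0 T, g t φ * η t := by
  set w : Lp V 2 (timeMeasure T) := A.compLpL 2 (timeMeasure T) (stateV hT.le ι A B y₀ u) +
    controlTerm T B u (stateC hT.le ι A B y₀ u) with hw
  -- The Riesz map turns `-(A z + B(u) y)`, an element of L²(0,T; V), into the time derivative in
  -- L²(0,T; V*).
  set ip : V →L[ℝ] V →L[ℝ] ℝ :=
    (isBoundedBilinearMap_inner (𝕜 := ℝ) (E := V)).toContinuousLinearMap with hip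
  refine ⟨(-ip).compLpL 2 (timeMeasure T) w, fun φ η hη => ?_⟩
  rw [stateV_weak hT hι hA hu y₀ φ hη, ← integral_neg]
  refine integral_congr_ae ?_
  filter_upwards [(-ip).coeFn_compLpL (p := 2) (μ := timeMeasure T) w,
    Lp.coeFn_add (A.compLpL 2 (timeMeasure T) (stateV hT.le ι A B y₀ u))
      (controlTerm T B u (stateC hT.le ι A B y₀ u)),
    A.coeFn_compLpL (p := 2) (μ := timeMeasure T) (stateV hT.le ι A B y₀ u),
    coeFn_controlTerm (B := B) u (stateC hT.le ι A B y₀ u), stateC_ae hT hι hA hu y₀]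
    with t h1 h2 h3 h4 h5
  rw [h1, hw, h2, Pi.add_apply, h3, h4, h5]
  change _ = -(-⟪_, φ⟫ * η t)
  ring

end Parabolic

/-! ### The cost as a smooth function of the state and of the control in L². -/

section Tracking

variable {H : Type*} [NormedAddCommGroup H] [InnerProductSpace ℝ H] {T : ℝ}

/-- The part of the cost that depends on the state. -/
def trackingCost (αQ αT : ℝ) (yQ : Lp H 2 (timeMeasure T)) (yT : H)
    (y : BoundedContinuousFunction ℝ H) : ℝ :=
  αQ / 2 * ‖BoundedContinuousFunction.toLp 2 (timeMeasure T) ℝ y - yQ‖ ^ 2 +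
    αT / 2 * ‖y T - yT‖ ^ 2

lemma contDiff_trackingCost (αQ αT : ℝ) (yQ : Lp H 2 (timeMeasure T)) (yT : H)
    {k : WithTop ℕ∞} : ContDiff ℝ k (trackingCost αQ αT yQ yT) := by
  have h1 : ContDiff ℝ k fun y : BoundedContinuousFunction ℝ H =>
      BoundedContinuousFunction.toLp 2 (timeMeasure T) ℝ y - yQ :=
    (ContinuousLinearMap.contDiff _).sub contDiff_const
  have h2 : ContDiff ℝ k fun y : BoundedContinuousFunction ℝ H => y T - yT :=
    (BoundedContinuousFunction.evalCLM ℝ T : BoundedContinuousFunction ℝ H →L[ℝ] H).contDiff.sub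
      contDiff_const
  exact (contDiff_const.mul (h1.norm_sq ℝ)).add (contDiff_const.mul (h2.norm_sq ℝ))

lemma trackingCost_eq (αQ αT : ℝ) (yQ : Lp H 2 (timeMeasure T)) (yT : H)
    {y : BoundedContinuousFunction ℝ H} {z : ℝ → H} (h : ∀ᵐ t ∂(timeMeasure T), y t = z t) :
    trackingCost αQ αT yQ yT y =
      αQ / 2 * (∫ t in Ioo 0 T, ‖z t - yQ t‖ ^ 2) + αT / 2 * ‖y T - yT‖ ^ 2 := by
  rw [trackingCost, norm_sq_eq_integral]
  congr 2
  refine integral_congr_ae ?_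
  filter_upwards [Lp.coeFn_sub (BoundedContinuousFunction.toLp 2 (timeMeasure T) ℝ y) yQ,
    h, BoundedContinuousFunction.coeFn_toLp 2 (timeMeasure T) ℝ y] with t h1 h2 h3
  rw [h1, Pi.sub_apply, h3, h2]

end Tracking

section Controls

variable {n : ℕ} {T : ℝ}

lemma ae_norm_le_UInf (u : UInf n T) : ∀ᵐ t ∂(timeMeasure T), ‖toU2 u t‖ ≤ ‖u‖ := by
  have h := ae_le_eLpNormEssSup (f := u) (μ := timeMeasure T)
  filter_upwards [h] with t ht
  have h1 : ‖u‖ = (eLpNormEssSup u (timeMeasure T)).toReal := by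
    rw [Lp.norm_def, eLpNorm_exponent_top]
  have h2 : eLpNormEssSup u (timeMeasure T) ≠ (⊤ : ℝ≥0∞) := by
    have := Lp.eLpNorm_ne_top u
    rwa [eLpNorm_exponent_top] at this
  rw [h1]
  change ‖u t‖ ≤ _
  rw [← toReal_enorm]
  exact ENNReal.toReal_mono h2 ht

/-- The embedding of `L^∞(0,T; ℝⁿ)` in `L²(0,T; ℝⁿ)` as a continuous linear map. -/
def toU2L (n : ℕ) (T : ℝ) : UInf n T →L[ℝ] U2 n T :=
  LinearMap.mkContinuous
    { toFun := toU2
      map_add' := fun _ _ => rfl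
      map_smul' := fun _ _ => rfl } (√((timeMeasure T).real univ)) fun u => by
    refine (pow_le_pow_iff_left₀ (norm_nonneg _) (by positivity) two_ne_zero).1 ?_
    rw [mul_pow, Real.sq_sqrt measureReal_nonneg]
    change ‖toU2 u‖ ^ 2 ≤ _
    rw [norm_sq_eq_integral]
    have : ∫ _ : ℝ, ‖u‖ ^ 2 ∂(timeMeasure T) = (timeMeasure T).real univ * ‖u‖ ^ 2 := by
      rw [integral_const, smul_eq_mul]
    rw [← this]
    refine integral_mono_ae (integrable_norm_sq _) (integrable_const _) ?_
    filter_upwards [ae_norm_le_UInf u] with t ht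
    gcongr

/-- The `i`-th component of a control. -/
def component (i : Fin n) : U2 n T →L[ℝ] Lp ℝ 2 (timeMeasure T) :=
  (EuclideanSpace.proj i : E n →L[ℝ] ℝ).compLpL 2 (timeMeasure T)

lemma coeFn_component (i : Fin n) (u : U2 n T) :
    component i u =ᵐ[timeMeasure T] fun t => u t i :=
  (EuclideanSpace.proj i : E n →L[ℝ] ℝ).coeFn_compLpL (p := 2) (μ := timeMeasure T) u

/-- The cost of a control. -/
def controlCost (γ β : Fin n → ℝ) (u : U2 n T) : ℝ :=
  ∑ i, (γ i * ‖component i u‖ ^ 2 + β i * ⟪Lp.const 2 (timeMeasure T) (1 : ℝ), component i u⟫)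

lemma controlCost_eq (γ β : Fin n → ℝ) (u : U2 n T) : controlCost γ β u =
    ∑ i, (γ i * (∫ t in Ioo 0 T, u t i ^ 2) + β i * ∫ t in Ioo 0 T, u t i) := by
  refine Finset.sum_congr rfl fun i _ => ?_
  congr 2
  · rw [norm_sq_eq_integral]
    refine integral_congr_ae ?_
    filter_upwards [coeFn_component i u] with t ht
    rw [ht, Real.norm_eq_abs, sq_abs]
  · rw [L2.inner_def]
    refine integral_congr_ae ?_
    filter_upwards [coeFn_component i u, Lp.coeFn_const 2 (timeMeasure T) (1 : ℝ)] with t ht ht'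
    rw [ht, ht']
    simp

lemma contDiff_controlCost (γ β : Fin n → ℝ) {k : WithTop ℕ∞} :
    ContDiff ℝ k (controlCost (T := T) γ β) := by
  refine ContDiff.sum fun i _ => ?_
  have h1 : ContDiff ℝ k (component (T := T) i) := ContinuousLinearMap.contDiff _
  exact (contDiff_const.mul (h1.norm_sq ℝ)).add
    (contDiff_const.mul (contDiff_const.inner ℝ h1))

end Controls

/-! ### Weak solutions of the state equation and the reduced cost on L². -/

namespace Data

variable {n : ℕ} {P : Data n}

/-- The continuous state `y ∈ C([0,T]; L²(Ω))` belonging to a control. -/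
def contState (hP : P.Standing) (u : U2 n P.T) : BoundedContinuousFunction ℝ (L2 P.Ω) :=
  stateC hP.T_pos.le (H1toL2 P.Ω) P.opA P.opB P.ρ₀ u

/-- The state in `L²(0,T; H¹(Ω))` belonging to a control. -/
def weakState (hP : P.Standing) (u : U2 n P.T) : L2H1 P.Ω P.T :=
  stateV hP.T_pos.le (H1toL2 P.Ω) P.opA P.opB P.ρ₀ u

lemma isRegular (hP : P.Standing) (u : UInf n P.T) :
    IsRegular hP.T_pos.le (H1toL2 P.Ω) P.opA P.opB (toU2 u) := by
  obtain ⟨α, lam, hA⟩ := P.garding hP.ν_pos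
  exact isRegular_of_bounded hP.T_pos (denseRange_H1toL2 hP.isOpen) hA (ae_norm_le_UInf u)

lemma contState_ae (hP : P.Standing) (u : UInf n P.T) :
    ∀ᵐ t ∂(timeMeasure P.T), contState hP (toU2 u) t = H1val (weakState hP (toU2 u) t) := by
  obtain ⟨α, lam, hA⟩ := P.garding hP.ν_pos
  have h := stateC_ae hP.T_pos (denseRange_H1toL2 hP.isOpen) hA (isRegular hP u) P.ρ₀
  filter_upwards [h] with t ht using ht

lemma hasValueAt_weakState (hP : P.Standing) (u : UInf n P.T) (t : ℝ) :
    HasValueAt (weakState hP (toU2 u)) t (contState hP (toU2 u) t) :=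
  ⟨contState hP (toU2 u), (contState hP (toU2 u)).continuous.continuousOn, contState_ae hP u, rfl⟩

lemma isWeakSolution_weakState (hP : P.Standing) (u : UInf n P.T) :
    P.IsWeakSolution u (weakState hP (toU2 u)) := by
  obtain ⟨α, lam, hA⟩ := P.garding hP.ν_pos
  have hι := denseRange_H1toL2 hP.isOpen
  refine ⟨?_, fun φ η hη => ?_, ?_⟩
  · exact stateV_timeDeriv hP.T_pos hι hA (isRegular hP u) P.ρ₀
  · have h1 := stateV_weak hP.T_pos hι hA (isRegular hP u) P.ρ₀ φ hη
    simp only [P.a_eq_inner]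
    exact neg_add_eq_zero.2 h1
  · have h1 := hasValueAt_weakState hP u 0
    have h2 : contState hP (toU2 u) 0 = P.ρ₀ :=
      stateC_zero hP.T_pos hι hA (isRegular hP u) P.ρ₀
    rwa [h2] at h1

lemma eq_weakState (hP : P.Standing) {u : UInf n P.T} {ρ : L2H1 P.Ω P.T}
    (h : P.IsWeakSolution u ρ) : ρ = weakState hP (toU2 u) := by
  obtain ⟨α, lam, hA⟩ := P.garding hP.ν_pos
  obtain ⟨-, h1, y, hy1, hy2, hy3⟩ := h
  refine eq_stateV_of_weak hP.T_pos (denseRange_H1toL2 hP.isOpen) hA (isRegular hP u)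
    hy1 hy2 hy3 fun φ η hη => ?_
  have h2 := h1 φ η hη
  simp only [P.a_eq_inner] at h2
  exact neg_add_eq_zero.1 h2

/-- Existence and uniqueness of weak solutions. -/
lemma existsUnique_isWeakSolution (hP : P.Standing) (u : UInf n P.T) :
    ∃! ρ, P.IsWeakSolution u ρ :=
  ⟨weakState hP (toU2 u), isWeakSolution_weakState hP u, fun _ h => eq_weakState hP h⟩

lemma G_eq (hP : P.Standing) (u : UInf n P.T) : P.G u = weakState hP (toU2 u) :=
  eq_weakState hP (Classical.epsilon_spec ⟨_, isWeakSolution_weakState hP u⟩)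

/-- Continuous functions on `[0,T]` that agree almost everywhere agree everywhere, endpoints
included. Hence the choice made in `valueAt` is forced. -/
lemma hasValueAt_unique {T : ℝ} (hT : 0 < T) {Ω : Set (E n)} {ρ : L2H1 Ω T} {t : ℝ}
    (ht : t ∈ Icc 0 T) {x x' : L2 Ω} (h : HasValueAt ρ t x) (h' : HasValueAt ρ t x') : x = x' := by
  obtain ⟨y, hy1, hy2, rfl⟩ := h
  obtain ⟨y', hy1', hy2', rfl⟩ := h'
  refine Measure.eqOn_Icc_of_ae_eq volume hT.ne ?_ hy1 hy1' ht
  rw [← restrict_Ioo_eq_restrict_Icc]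
  filter_upwards [hy2, hy2'] with s h1 h2
  rw [h1, h2]

lemma valueAt_weakState (hP : P.Standing) (u : UInf n P.T) :
    valueAt (weakState hP (toU2 u)) P.T = contState hP (toU2 u) P.T :=
  hasValueAt_unique hP.T_pos (right_mem_Icc.2 hP.T_pos.le)
    (Classical.epsilon_spec ⟨_, hasValueAt_weakState hP u P.T⟩) (hasValueAt_weakState hP u P.T)

/-- The reduced cost functional, regarded as a function of controls in `L²(0,T; ℝⁿ)`. -/
def reducedCost (hP : P.Standing) (u : U2 n P.T) : ℝ :=
  trackingCost P.αQ P.αΩ P.ρQ P.ρΩ (contState hP u) + controlCost P.γ P.β u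

lemma F_eq (hP : P.Standing) (u : UInf n P.T) : P.F u = reducedCost hP (toU2 u) := by
  unfold F J reducedCost
  rw [G_eq hP, controlCost_eq, valueAt_weakState,
    trackingCost_eq P.αQ P.αΩ P.ρQ P.ρΩ (contState_ae hP u)]
  rfl

/-- Smoothness holds in the L² topology, though only at bounded controls; this is the source of the
extensions of `F'` and `F''`. -/
lemma contDiffAt_reducedCost (hP : P.Standing) (u : UInf n P.T) {k : WithTop ℕ∞} :
    ContDiffAt ℝ k (reducedCost hP) (toU2 u) := by
  have h1 : ContDiffAt ℝ k (contState hP) (toU2 u) :=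
    contDiffAt_stateC hP.T_pos.le (isRegular hP u) P.ρ₀
  have h2 := (contDiff_trackingCost P.αQ P.αΩ P.ρQ P.ρΩ (k := k)).contDiffAt
    (x := contState hP (toU2 u))
  exact (h2.comp (toU2 u) h1).add (contDiff_controlCost P.γ P.β).contDiffAt

lemma F_eq_comp (hP : P.Standing) : P.F = reducedCost hP ∘ toU2L n P.T :=
  funext fun u => F_eq hP u

lemma contDiff_F (hP : P.Standing) {k : WithTop ℕ∞} : ContDiff ℝ k P.F := by
  rw [F_eq_comp hP, contDiff_iff_contDiffAt]
  exact fun u => (contDiffAt_reducedCost hP u).comp u (toU2L n P.T).contDiff.contDiffAt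

lemma fderiv_F (hP : P.Standing) (u : UInf n P.T) :
    fderiv ℝ P.F u = (fderiv ℝ (reducedCost hP) (toU2 u)).comp (toU2L n P.T) := by
  rw [F_eq_comp hP]
  have h := ((contDiffAt_reducedCost hP u (k := 1)).differentiableAt one_ne_zero).hasFDerivAt
  exact (h.comp u (toU2L n P.T).hasFDerivAt).fderiv

lemma isExtensionOfDeriv (hP : P.Standing) (u : UInf n P.T) :
    P.IsExtensionOfDeriv u (fderiv ℝ (reducedCost hP) (toU2 u)) := by
  intro v
  rw [fderiv_F hP]
  rfl

/-- The derivative of `F` is the derivative on L² restricted along the embedding, a fixed continuous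
linear operation, so the chain rule applies once more. -/
lemma isExtensionOfSecondDeriv (hP : P.Standing) (u : UInf n P.T) :
    P.IsExtensionOfSecondDeriv u (fderiv ℝ (fderiv ℝ (reducedCost hP)) (toU2 u)) := by
  intro v w
  have h0 : fderiv ℝ P.F = fun u =>
      (ContinuousLinearMap.compL ℝ (UInf n P.T) (U2 n P.T) ℝ).flip (toU2L n P.T)
        (fderiv ℝ (reducedCost hP) (toU2L n P.T u)) := by
    funext u
    rw [fderiv_F hP]
    rfl
  have h1 : HasFDerivAt (fderiv ℝ (reducedCost hP))
      (fderiv ℝ (fderiv ℝ (reducedCost hP)) (toU2L n P.T u)) (toU2L n P.T u) :=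
    (((contDiffAt_reducedCost hP u (k := 2)).fderiv_right (m := 1) le_rfl).differentiableAt
      one_ne_zero).hasFDerivAt
  have h2 := ((ContinuousLinearMap.compL ℝ (UInf n P.T) (U2 n P.T) ℝ).flip
    (toU2L n P.T)).hasFDerivAt.comp u (h1.comp u (toU2L n P.T).hasFDerivAt)
  rw [h0]
  have h3 := h2.fderiv
  exact (DFunLike.congr_fun (DFunLike.congr_fun h3 v) w).symm

end Data

/-! ### Second order conditions -/

lemma deriv_nonneg_of_le_right {g : ℝ → ℝ} (hg : DifferentiableAt ℝ g 0) {δ : ℝ} (hδ : 0 < δ)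
    (h : ∀ τ, 0 ≤ τ → τ < δ → g 0 ≤ g τ) : 0 ≤ deriv g 0 := by
  have h1 := hasDerivWithinAt_iff_tendsto_slope.1
    (hg.hasDerivAt.hasDerivWithinAt (s := Ioi 0))
  have h2 : Ioi (0 : ℝ) \ {0} = Ioi 0 := by simp
  rw [h2] at h1
  refine ge_of_tendsto h1 ?_
  filter_upwards [Ioo_mem_nhdsGT hδ] with τ hτ
  rw [slope_def_field, sub_zero]
  exact div_nonneg (sub_nonneg.2 (h τ hτ.1.le hτ.2)) hτ.1.le

/-- If `g''(0) < 0`, then `g + ε τ²` with `ε = -g''(0)/4` still has second derivative `g''(0)/2 < 0`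
and so a local maximum at `0`. But it exceeds its value at `0` strictly for small `τ > 0`. The added
square turns the weak minimality of `g` into this strict inequality. -/
lemma deriv_deriv_nonneg_of_le_right {g : ℝ → ℝ} (hg : ContDiff ℝ 2 g) {δ : ℝ} (hδ : 0 < δ)
    (h : ∀ τ, 0 ≤ τ → τ < δ → g 0 ≤ g τ) (h0 : deriv g 0 = 0) : 0 ≤ deriv (deriv g) 0 := by
  by_contra hneg
  push Not at hneg
  set ε := -deriv (deriv g) 0 / 4 with hε
  have hε0 : 0 < ε := by rw [hε]; linarith
  set k : ℝ → ℝ := fun τ => g τ + ε * τ ^ 2 with hk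
  have hgd : ∀ τ, HasDerivAt g (deriv g τ) τ := fun τ =>
    (hg.differentiable (by simp) τ).hasDerivAt
  have hg' : ContDiff ℝ 1 (deriv g) := by
    have := (contDiff_succ_iff_deriv (n := 1) (f := g)).1 (by simpa [one_add_one_eq_two] using hg)
    exact this.2.2
  have hkd : deriv k = fun τ => deriv g τ + ε * (2 * τ) := by
    funext τ
    have h1 : HasDerivAt (fun τ : ℝ => ε * τ ^ 2) (ε * (2 * τ)) τ := by
      simpa using (hasDerivAt_pow 2 τ).const_mul ε
    exact ((hgd τ).add h1).deriv
  have hkdd : deriv (deriv k) 0 = deriv (deriv g) 0 + ε * 2 := by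
    rw [hkd]
    have h1 : HasDerivAt (fun τ : ℝ => ε * (2 * τ)) (ε * 2) 0 := by
      simpa using ((hasDerivAt_id (0 : ℝ)).const_mul 2).const_mul ε
    exact (((hg'.differentiable one_ne_zero) 0).hasDerivAt.add h1).deriv
  have hmax : IsLocalMax k 0 := by
    refine isLocalMax_of_deriv_deriv_neg ?_ ?_ ?_
    · rw [hkdd, hε]; linarith
    · rw [hkd]; simp [h0]
    · exact (hg.continuous.add (by fun_prop)).continuousAt
  have h1 : ∀ᶠ τ in 𝓝[>] (0 : ℝ), k τ ≤ k 0 := hmax.filter_mono nhdsWithin_le_nhds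
  obtain ⟨τ, hτ, hτ'⟩ := (h1.and (Ioo_mem_nhdsGT hδ)).exists
  have h2 := h τ hτ'.1.le hτ'.2
  simp only [hk] at hτ
  have h3 : 0 < ε * τ ^ 2 := mul_pos hε0 (pow_pos hτ'.1 2)
  norm_num at hτ
  linarith

lemma deriv_comp_line {X : Type*} [NormedAddCommGroup X] [NormedSpace ℝ X] {f : X → ℝ}
    (hf : ContDiff ℝ 2 f) (u v : X) :
    deriv (fun τ : ℝ => f (u + τ • v)) = fun τ => fderiv ℝ f (u + τ • v) v := by
  funext τ
  have h1 : HasDerivAt (fun τ : ℝ => u + τ • v) v τ := by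
    simpa using ((hasDerivAt_id τ).smul_const v).const_add u
  exact (((hf.differentiable (by simp) _).hasFDerivAt).comp_hasDerivAt τ h1).deriv

lemma deriv_deriv_comp_line {X : Type*} [NormedAddCommGroup X] [NormedSpace ℝ X] {f : X → ℝ}
    (hf : ContDiff ℝ 2 f) (u v : X) :
    deriv (deriv (fun τ : ℝ => f (u + τ • v))) 0 = fderiv ℝ (fderiv ℝ f) u v v := by
  rw [deriv_comp_line hf]
  have h1 : HasDerivAt (fun τ : ℝ => u + τ • v) v 0 := by
    simpa using ((hasDerivAt_id (0 : ℝ)).smul_const v).const_add u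
  have h2 : ContDiff ℝ 1 (fderiv ℝ f) := hf.fderiv_right le_rfl
  have h3 : HasFDerivAt (fderiv ℝ f) (fderiv ℝ (fderiv ℝ f) u) (u + (0 : ℝ) • v) := by
    rw [zero_smul, add_zero]
    exact (h2.differentiable one_ne_zero u).hasFDerivAt
  exact ((ContinuousLinearMap.apply ℝ ℝ v).hasFDerivAt.comp_hasDerivAt (0 : ℝ)
    (h3.comp_hasDerivAt (0 : ℝ) h1)).deriv

/-! ### Bounded feasible approximations of directions in the tangent cone. -/

section Truncation

variable {n : ℕ} {T : ℝ}

/-- The control `u`, with values in `[u₀, u₁]`, keeps a distance of at least `1/(k+1)` from the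
bounds it does not attain, and `v` is bounded by `k` (at the time `t`, in the component `i`). -/
def IsGood (u u₀ u₁ : UInf n T) (v : U2 n T) (k : ℕ) (t : ℝ) (i : Fin n) : Prop :=
  |v t i| ≤ k ∧ (u t i = u₀ t i ∨ u₀ t i + 1 / ((k : ℝ) + 1) ≤ u t i) ∧
    (u t i = u₁ t i ∨ u t i + 1 / ((k : ℝ) + 1) ≤ u₁ t i)

open Classical in
/-- The function `v`, replaced by `0` where it is large or `u` is close to the bounds. -/
def truncFun (u u₀ u₁ : UInf n T) (v : U2 n T) (k : ℕ) (t : ℝ) : E n :=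
  WithLp.toLp 2 fun i => if IsGood u u₀ u₁ v k t i then v t i else 0

lemma measurable_component {p : ℝ≥0∞} (u : Lp (E n) p (timeMeasure T)) (i : Fin n) :
    Measurable fun t => u t i :=
  (EuclideanSpace.proj i : E n →L[ℝ] ℝ).measurable.comp (Lp.stronglyMeasurable u).measurable

lemma measurable_truncFun (u u₀ u₁ : UInf n T) (v : U2 n T) (k : ℕ) :
    Measurable (truncFun u u₀ u₁ v k) := by
  refine (WithLp.measurable_toLp 2 (Fin n → ℝ)).comp (measurable_pi_lambda _ fun i => ?_)
  have hu := measurable_component u i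
  have hu₀ := measurable_component u₀ i
  have hu₁ := measurable_component u₁ i
  have hv := measurable_component v i
  refine Measurable.ite ?_ hv measurable_const
  exact (measurableSet_le hv.abs measurable_const).inter
    (((measurableSet_eq_fun hu hu₀).union (measurableSet_le (hu₀.add_const _) hu)).inter
      ((measurableSet_eq_fun hu hu₁).union (measurableSet_le (hu.add_const _) hu₁)))

lemma abs_truncFun_le (u u₀ u₁ : UInf n T) (v : U2 n T) (k : ℕ) (t : ℝ) (i : Fin n) :
    |truncFun u u₀ u₁ v k t i| ≤ k := by
  simp only [truncFun]
  split_ifs with h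
  · exact h.1
  · simp

lemma memLp_truncFun (u u₀ u₁ : UInf n T) (v : U2 n T) (k : ℕ) :
    MemLp (truncFun u u₀ u₁ v k) ∞ (timeMeasure T) := by
  refine memLp_top_of_bound (measurable_truncFun u u₀ u₁ v k).aestronglyMeasurable
    (√(∑ _ : Fin n, (k : ℝ) ^ 2)) (ae_of_all _ fun t => ?_)
  rw [EuclideanSpace.norm_eq]
  refine Real.sqrt_le_sqrt (Finset.sum_le_sum fun i _ => ?_)
  rw [Real.norm_eq_abs]
  exact pow_le_pow_left₀ (abs_nonneg _) (abs_truncFun_le u u₀ u₁ v k t i) 2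

/-- The truncation of a direction `v ∈ L²(0,T; ℝⁿ)`. -/
def trunc (u u₀ u₁ : UInf n T) (v : U2 n T) (k : ℕ) : UInf n T :=
  (memLp_truncFun u u₀ u₁ v k).toLp _

lemma coeFn_trunc (u u₀ u₁ : UInf n T) (v : U2 n T) (k : ℕ) :
    trunc u u₀ u₁ v k =ᵐ[timeMeasure T] truncFun u u₀ u₁ v k :=
  (memLp_truncFun u u₀ u₁ v k).coeFn_toLp

/-- The tangent cone to the set of controls between `u₀` and `u₁`. -/
def tangentCone (u u₀ u₁ : UInf n T) : Set (U2 n T) :=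
  {v | ∀ᵐ t ∂(timeMeasure T), ∀ i, (u t i = u₀ t i → 0 ≤ v t i) ∧ (u t i = u₁ t i → v t i ≤ 0)}

lemma mem_tangentCone {u u₀ u₁ : UInf n T} {v : U2 n T} : v ∈ tangentCone u u₀ u₁ ↔
    ∀ᵐ t ∂(timeMeasure T), ∀ i, (u t i = u₀ t i → 0 ≤ v t i) ∧ (u t i = u₁ t i → v t i ≤ 0) :=
  Iff.rfl

/-- At a fixed time a bound that is not attained has positive distance from `u`, and `v` is finite,
so the truncation eventually leaves `v` unchanged. -/
lemma eventually_isGood {u u₀ u₁ : UInf n T} {v : U2 n T} {t : ℝ} {i : Fin n}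
    (h : u₀ t i ≤ u t i ∧ u t i ≤ u₁ t i) : ∀ᶠ k : ℕ in atTop, IsGood u u₀ u₁ v k t i := by
  have hlim := tendsto_one_div_add_atTop_nhds_zero_nat (𝕜 := ℝ)
  have key : ∀ a b : ℝ, a ≤ b → ∀ᶠ k : ℕ in atTop, b = a ∨ a + 1 / ((k : ℝ) + 1) ≤ b := by
    intro a b hab
    rcases hab.eq_or_lt with h | h
    · exact Eventually.of_forall fun k => Or.inl h.symm
    · filter_upwards [hlim.eventually (gt_mem_nhds (sub_pos.2 h))] with k hk
      right
      linarith
  filter_upwards [key _ _ h.1, key _ _ h.2, eventually_ge_atTop ⌈|v t i|⌉₊] with k h1 h2 h3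
  exact ⟨(Nat.le_ceil _).trans (by exact_mod_cast h3), h1, h2.imp Eq.symm id⟩

/-- Dominated convergence: the error is eventually zero at almost every time and never exceeds
`‖v‖²` after squaring. -/
lemma tendsto_trunc {u u₀ u₁ : UInf n T} (v : U2 n T)
    (hu : ∀ᵐ t ∂(timeMeasure T), ∀ i, u₀ t i ≤ u t i ∧ u t i ≤ u₁ t i) :
    Tendsto (fun k => toU2 (trunc u u₀ u₁ v k)) atTop (𝓝 v) := by
  rw [tendsto_iff_norm_sub_tendsto_zero]
  have h1 : Tendsto (fun k => ∫ t, ‖truncFun u u₀ u₁ v k t - v t‖ ^ 2 ∂(timeMeasure T)) atTop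
      (𝓝 (∫ _ : ℝ, (0 : ℝ) ∂(timeMeasure T))) := by
    refine tendsto_integral_of_dominated_convergence (fun t => ‖v t‖ ^ 2) (fun k => ?_)
      (integrable_norm_sq v) (fun k => ae_of_all _ fun t => ?_) ?_
    · exact (((measurable_truncFun u u₀ u₁ v k).sub
        (Lp.stronglyMeasurable v).measurable).norm.pow_const 2).aestronglyMeasurable
    · rw [norm_pow, norm_norm, EuclideanSpace.norm_sq_eq, EuclideanSpace.norm_sq_eq]
      refine Finset.sum_le_sum fun i _ => ?_
      simp only [truncFun, PiLp.sub_apply]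
      split_ifs with h <;> simp [sq_nonneg]
    · filter_upwards [hu] with t ht
      refine tendsto_const_nhds.congr' ?_
      filter_upwards [eventually_all.2 fun i => eventually_isGood (v := v) (ht i)] with k hk
      have : truncFun u u₀ u₁ v k t = v t := by
        ext i
        simp [truncFun, hk i]
      simp [this]
  have h2 : ∀ k, ‖toU2 (trunc u u₀ u₁ v k) - v‖ ^ 2 =
      ∫ t, ‖truncFun u u₀ u₁ v k t - v t‖ ^ 2 ∂(timeMeasure T) := by
    intro k
    rw [norm_sq_eq_integral]
    refine integral_congr_ae ?_
    filter_upwards [Lp.coeFn_sub (toU2 (trunc u u₀ u₁ v k)) v, coeFn_trunc u u₀ u₁ v k]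
      with t h1 h2
    have h3 : toU2 (trunc u u₀ u₁ v k) t = truncFun u u₀ u₁ v k t := h2
    rw [h1, Pi.sub_apply, h3]
  simp only [← h2, integral_zero] at h1
  have h3 := h1.sqrt
  simpa using h3

/-- Where `v` is kept, `|v| ≤ k` and `τ < 1/(k+1)²` make the step at most `1/(k+1)`, which is the
distance kept from bounds that are not attained. At attained bounds the sign of `v` points inwards.
-/
lemma trunc_add_mem {u u₀ u₁ : UInf n T} {v : U2 n T}
    (hu : ∀ᵐ t ∂(timeMeasure T), ∀ i, u₀ t i ≤ u t i ∧ u t i ≤ u₁ t i)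
    (hv : v ∈ tangentCone u u₀ u₁) (k : ℕ) {τ : ℝ} (hτ : 0 ≤ τ)
    (hτ' : τ < (1 / ((k : ℝ) + 1)) ^ 2) :
    ∀ᵐ t ∂(timeMeasure T), ∀ i, u₀ t i ≤ (u + τ • trunc u u₀ u₁ v k) t i ∧
      (u + τ • trunc u u₀ u₁ v k) t i ≤ u₁ t i := by
  filter_upwards [hu, mem_tangentCone.1 hv, coeFn_trunc u u₀ u₁ v k,
    Lp.coeFn_add u (τ • trunc u u₀ u₁ v k), Lp.coeFn_smul τ (trunc u u₀ u₁ v k)]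
    with t h1 h2 h3 h4 h5 i
  rw [h4, Pi.add_apply, h5, Pi.smul_apply, h3]
  simp only [truncFun, PiLp.add_apply, PiLp.smul_apply, smul_eq_mul]
  obtain ⟨h6, h7⟩ := h1 i
  obtain ⟨h8, h9⟩ := h2 i
  split_ifs with hg
  · obtain ⟨g1, g2, g3⟩ := hg
    have hk : (0 : ℝ) < (k : ℝ) + 1 := by positivity
    have hb : |τ * v t i| ≤ 1 / ((k : ℝ) + 1) := by
      rw [abs_mul, abs_of_nonneg hτ]
      calc τ * |v t i| ≤ (1 / ((k : ℝ) + 1)) ^ 2 * ((k : ℝ) + 1) := by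
            gcongr
            linarith
        _ = 1 / ((k : ℝ) + 1) := by field_simp
    obtain ⟨b1, b2⟩ := abs_le.1 hb
    constructor
    · rcases g2 with g | g
      · have := mul_nonneg hτ (h8 g)
        linarith
      · linarith
    · rcases g3 with g | g
      · have := mul_nonneg hτ (neg_nonneg.2 (h9 g))
        linarith
      · linarith
  · simpa using h1 i

/-- Each component of the difference is `0` or that of `v`, so the sign conditions persist. -/
lemma sub_trunc_mem {u u₀ u₁ : UInf n T} {v : U2 n T} (hv : v ∈ tangentCone u u₀ u₁) (k : ℕ) :
    v - toU2 (trunc u u₀ u₁ v k) ∈ tangentCone u u₀ u₁ := by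
  rw [mem_tangentCone]
  filter_upwards [mem_tangentCone.1 hv, Lp.coeFn_sub v (toU2 (trunc u u₀ u₁ v k)),
    coeFn_trunc u u₀ u₁ v k] with t h1 h2 h3 i
  have h4 : toU2 (trunc u u₀ u₁ v k) t = truncFun u u₀ u₁ v k t := h3
  rw [h2, Pi.sub_apply, h4]
  simp only [truncFun, PiLp.sub_apply]
  split_ifs
  · simp
  · simpa using h1 i

end Truncation

/-! ### The second order condition on the critical cone. -/

namespace Data

variable {n : ℕ} {P : Data n}

/-- Feasible directions have the required signs, and signs survive limits in L² because a
subsequence converges almost everywhere. -/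
lemma closure_feasibleCone_subset (u : UInf n P.T) :
    closure (toU2 '' P.feasibleCone u) ⊆ tangentCone u P.umin P.umax := by
  intro v hv
  obtain ⟨w, hw, hlim⟩ := mem_closure_iff_seq_limit.1 hv
  obtain ⟨ns, -, hns⟩ := (tendstoInMeasure_of_tendsto_Lp hlim).exists_seq_tendsto_ae
  have hmem : ∀ᵐ t ∂(timeMeasure P.T), ∀ k, ∀ i,
      (u t i = P.umin t i → 0 ≤ w k t i) ∧ (u t i = P.umax t i → w k t i ≤ 0) := by
    refine ae_all_iff.2 fun k => ?_
    obtain ⟨x, ⟨l, hl, y, hy, rfl⟩, hx⟩ := hw k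
    have hy' : ∀ᵐ t ∂(timeMeasure P.T), ∀ i, P.umin t i ≤ y t i ∧ y t i ≤ P.umax t i := hy
    filter_upwards [hy', Lp.coeFn_smul l (y - u), Lp.coeFn_sub y u] with t h1 h2 h3 i
    have h4 : w k t i = l * (y t i - u t i) := by
      rw [← hx]
      change (l • (y - u) : UInf n P.T) t i = _
      rw [h2, Pi.smul_apply, h3]
      simp
    rw [h4]
    refine ⟨fun h => ?_, fun h => ?_⟩
    · rw [h]
      exact mul_nonneg hl.le (sub_nonneg.2 (h1 i).1)
    · rw [h]
      exact mul_nonpos_of_nonneg_of_nonpos hl.le (sub_nonpos.2 (h1 i).2)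
  rw [mem_tangentCone]
  filter_upwards [hmem, hns] with t h1 h2 i
  have h3 : Tendsto (fun j => w (ns j) t i) atTop (𝓝 (v t i)) :=
    ((EuclideanSpace.proj i : E n →L[ℝ] ℝ).continuous.tendsto _).comp h2
  exact ⟨fun h => ge_of_tendsto' h3 fun j => (h1 _ i).1 h,
    fun h => le_of_tendsto' h3 fun j => (h1 _ i).2 h⟩

lemma line_min {u v : UInf n P.T} (hu : P.IsLInftyLocalSolution u) {δ : ℝ} (hδ : 0 < δ)
    (hv : ∀ τ : ℝ, 0 ≤ τ → τ < δ → u + τ • v ∈ P.Uad) :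
    ∃ δ' > 0, ∀ τ : ℝ, 0 ≤ τ → τ < δ' → P.F (u + (0 : ℝ) • v) ≤ P.F (u + τ • v) := by
  obtain ⟨-, ε, hε, h⟩ := hu
  -- The second bound keeps the segment inside the ball of radius `ε`; the `+ 1` covers `v = 0`.
  refine ⟨min δ (ε / (‖v‖ + 1)), lt_min hδ (by positivity), fun τ h0 h1 => ?_⟩
  rw [zero_smul, add_zero]
  refine h _ ⟨hv τ h0 (h1.trans_le (min_le_left _ _)), ?_⟩
  rw [mem_ball_iff_norm, add_sub_cancel_left, norm_smul, Real.norm_eq_abs, abs_of_nonneg h0]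
  have h2 := h1.trans_le (min_le_right _ _)
  rw [lt_div_iff₀ (by positivity)] at h2
  nlinarith [norm_nonneg v]

/-- The second order necessary optimality condition. -/
lemma second_order_necessary (hF : ContDiff ℝ 2 P.F) {u : UInf n P.T}
    (hu : P.IsLInftyLocalSolution u) {F' : U2 n P.T →L[ℝ] ℝ}
    {F'' : U2 n P.T →L[ℝ] U2 n P.T →L[ℝ] ℝ} (h1 : P.IsExtensionOfDeriv u F')
    (h2 : P.IsExtensionOfSecondDeriv u F'') : ∀ v ∈ P.criticalCone u F', 0 ≤ F'' v v := by
  have huad : ∀ᵐ t ∂(timeMeasure P.T), ∀ i, P.umin t i ≤ u t i ∧ u t i ≤ P.umax t i := hu.1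
  have hline : ∀ v ∈ tangentCone u P.umin P.umax, ∀ k, ∃ δ > 0, ∀ τ : ℝ, 0 ≤ τ → τ < δ →
      P.F (u + (0 : ℝ) • trunc u P.umin P.umax v k) ≤
        P.F (u + τ • trunc u P.umin P.umax v k) := fun v hv k =>
    line_min hu (by positivity) fun τ hτ hτ' => trunc_add_mem huad hv k hτ hτ'
  have hc : ∀ w : UInf n P.T, ContDiff ℝ 2 fun τ : ℝ => P.F (u + τ • w) := fun w =>
    hF.comp (contDiff_const.add (contDiff_id.smul contDiff_const))
  have hd : ∀ w : UInf n P.T, deriv (fun τ : ℝ => P.F (u + τ • w)) 0 = F' (toU2 w) := by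
    intro w
    simp only [deriv_comp_line hF, h1 w, zero_smul, add_zero]
  have hnonneg : ∀ v ∈ tangentCone u P.umin P.umax, ∀ k,
      0 ≤ F' (toU2 (trunc u P.umin P.umax v k)) := by
    intro v hv k
    obtain ⟨δ, hδ, h⟩ := hline v hv k
    rw [← hd]
    exact deriv_nonneg_of_le_right ((hc _).differentiable (by simp) 0) hδ h
  -- Passing to the limit extends the first order condition to unbounded directions, such as the
  -- remainder `v - v_k` below.
  have hnonneg' : ∀ v ∈ tangentCone u P.umin P.umax, 0 ≤ F' v := fun v hv =>
    ge_of_tendsto' ((F'.continuous.tendsto v).comp (tendsto_trunc v huad)) fun k => hnonneg v hv k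
  rintro v ⟨hv, hv0⟩
  have hv0 : F' v = 0 := hv0
  replace hv := closure_feasibleCone_subset u hv
  -- `0 = F' v = F' v_k + F' (v - v_k)` with both summands nonnegative. So the truncations stay
  -- critical, as the second derivative test along the segment requires.
  have hzero : ∀ k, F' (toU2 (trunc u P.umin P.umax v k)) = 0 := by
    intro k
    have h3 := hnonneg v hv k
    have h4 := hnonneg' _ (sub_trunc_mem hv k)
    rw [map_sub, hv0] at h4
    linarith
  have hsecond : ∀ k, 0 ≤ F'' (toU2 (trunc u P.umin P.umax v k))
      (toU2 (trunc u P.umin P.umax v k)) := by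
    intro k
    obtain ⟨δ, hδ, h⟩ := hline v hv k
    rw [h2, ← deriv_deriv_comp_line hF]
    refine deriv_deriv_nonneg_of_le_right (hc _) hδ h ?_
    rw [hd, hzero]
  have hcont : Continuous fun v => F'' v v := by fun_prop
  exact ge_of_tendsto' ((hcont.tendsto v).comp (tendsto_trunc v huad)) hsecond

end Data

end FokkerPlanck

end

theorem mainTheorem2 {n : ℕ} (P : FokkerPlanck.Data n) (hP : P.Standing)
    (hb : P.BoundaryAssumption) (u : FokkerPlanck.UInf n P.T)
    (hu : P.IsLInftyLocalSolution u) :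
    (∀ w : FokkerPlanck.UInf n P.T, ∃! ρ, P.IsWeakSolution w ρ) ∧
    ContDiff ℝ 2 P.F ∧
    ∃ (F' : FokkerPlanck.U2 n P.T →L[ℝ] ℝ)
      (F'' : FokkerPlanck.U2 n P.T →L[ℝ] FokkerPlanck.U2 n P.T →L[ℝ] ℝ),
      P.IsExtensionOfDeriv u F' ∧ P.IsExtensionOfSecondDeriv u F'' ∧
      ∀ v ∈ P.criticalCone u F', 0 ≤ F'' v v :=
  ⟨FokkerPlanck.Data.existsUnique_isWeakSolution hP, FokkerPlanck.Data.contDiff_F hP, _, _,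
    FokkerPlanck.Data.isExtensionOfDeriv hP u, FokkerPlanck.Data.isExtensionOfSecondDeriv hP u,
    FokkerPlanck.Data.second_order_necessary (FokkerPlanck.Data.contDiff_F hP) hu
      (FokkerPlanck.Data.isExtensionOfDeriv hP u)
      (FokkerPlanck.Data.isExtensionOfSecondDeriv hP u)⟩
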